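/- **Setting.** Let $1<p,p'<\infty$ with $1/p+1/p'=1$, let $\mathbb T$ be the unit circle, and let $H^p\subset L^p=L^p(\mathbb T)$ be the Hardy space (functions whose Fourier coefficients of negative index vanish), with Riesz projection $\mathbb P:L^p\to H^p$. Let $\mathrm{Rat}(\mathbb T)$ be the rational functions with poles only on $\mathbb T$ and $\mathrm{Rat}_0(\mathbb T)$ the strictly proper ones among them. For a rational function $\omega$ let $T_\omega\,(H^p\to H^p)$ be given by $$\mathrm{Dom}(T_\omega)=\{g\in H^p:\ \omega g=f+\rho,\ f\in L^p,\ \rho\in\mathrm{Rat}_0(\mathbb T)\},\qquad T_\omega g=\mathbb P f.$$ The adjoint $T_\omega^*\,(H^{p'}\to H^{p'})$ is taken with respect to $\langle f,g\rangle=\frac1{2\pi}\int_{0}^{2\pi} f(e^{it})\overline{g(e^{it})}\,dt$: $g\in\mathrm{Dom}(T_\omega^*)$ and $T_\omega^*g=k$ if and only if $\langle T_\omega f,g\rangle=\langle f,k\rangle$ for all $f\in\mathrm{Dom}(T_\omega)$. Let $\omega^*$ be the rational function with $\omega^*(z)=\overline{\omega(z)}$ on $\mathbb T$; the operators $T_{\omega^*}$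 and $T_{z^{k}}$, $k\in\mathbb Z$, below act on $H^{p'}$. For a polynomial $r$ of degree $k$ put $r^\sharp(z)=z^k\overline{r(1/\bar z)}$. **Theorem.** Let $\omega=s/q\in\mathrm{Rat}(\mathbb T)$ with $s,q$ co-prime polynomials, $m=\deg q$, $n=\deg s$ (with $n=0$ if $s=0$). Then $T_\omega^*$ is a well-defined operator, $$\mathrm{Dom}(T_\omega^*)=q^\sharp H^{p'}\subset\mathrm{Dom}(T_{\omega^*}),\qquad T_\omega^*=T_{\omega^*}|_{q^\sharp H^{p'}},$$ and $T_\omega^*(q^\sharp v)=T_{z^{m-n}}s^\sharp v$ for all $v\in H^{p'}$. Moreover $$\mathrm{Ran}(T_\omega^*)=T_{z^{m-n}}s^\sharp H^{p'},$$ and whenever $s=s_-s_0s_+$ with polynomials $s_-,s_0,s_+$ having roots only inside, on, and outside $\mathbb T$, respectively, $$\mathrm{Ker}(T_\omega^*)=\Big\{\frac{q^\sharp r}{(s_-)^\sharp}:\ r \text{ a polynomial},\ \deg r<\deg s_--m\Big\},$$ where $r=0$ is always allowed. In particular, if $\omega\neq0$, then $\mathrm{Ker}(T_\omega^*)$ is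 finite dimensional with $$\dim\mathrm{Ker}(T_\omega^*)=\max\{0,\ \#\{\text{zeros of }\omega^*\text{ in }\{|z|>1\}\cup\{\infty\}\}-\#\{\text{poles of }\omega^*\text{ on }\mathbb T\}\},$$ and $T_\omega^*$ is injective if and only if $\omega$ has at least as many poles on $\mathbb T$ as zeros in the open unit disc; zeros and poles are counted with multiplicity. -/

import Mathlib

open MeasureTheory Polynomial
open scoped ENNReal

namespace ToeplitzLike

/-! ### The unit circle -/

instance factTwoPiPos : Fact (0 < 2 * Real.pi) := ⟨Real.two_pi_pos⟩

/-- The unit circle, parametrised by the angle `t ↦ e ^ (i t)`. -/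
abbrev Torus : Type := AddCircle (2 * Real.pi)

/-- Normalised arc length `dt / 2π` on the unit circle. -/
noncomputable abbrev arc : Measure Torus := AddCircle.haarAddCircle

/-- The point `z = e ^ (i t)` of the unit circle in `ℂ`. -/
noncomputable def pt (t : Torus) : ℂ := fourier 1 t

theorem norm_pt (t : Torus) : ‖pt t‖ = 1 := by
  rw [pt, fourier_apply]
  exact Circle.norm_coe _

theorem continuous_pt : Continuous pt := (fourier 1).continuous

theorem pt_injective : Function.Injective pt := by
  intro x y h
  simp only [pt, fourier_one] at h
  exact AddCircle.injective_toCircle (by positivity) (Subtype.ext h)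

theorem pt_coe (θ : ℝ) : pt (θ : Torus) = circleMap 0 1 θ := by
  have h : (Real.pi : ℂ) ≠ 0 := by exact_mod_cast Real.pi_ne_zero
  simp only [pt, fourier_coe_apply, circleMap]
  push_cast
  simp only [zero_add, one_mul]
  congr 1
  field_simp

theorem arc_singleton (t : Torus) : arc {t} = 0 := by
  have hv : (volume : Measure Torus) {t} = 0 := by
    have h := (AddCircle.measurePreserving_mk (2 * Real.pi) 0).measure_preimage
      (measurableSet_singleton t).nullMeasurableSet
    rw [← h]
    refine Set.Countable.measure_zero ?_ _
    obtain ⟨x, rfl⟩ := QuotientAddGroup.mk_surjective t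
    refine (Set.countable_range fun k : ℤ => x + k • (2 * Real.pi)).mono ?_
    intro y hy
    obtain ⟨k, hk⟩ := AddSubgroup.mem_zmultiples_iff.1 (QuotientAddGroup.eq.1 (Eq.symm hy))
    exact ⟨k, by simp only [hk]; ring⟩
  rw [AddCircle.volume_eq_smul_haarAddCircle, Measure.smul_apply, smul_eq_mul,
    mul_eq_zero] at hv
  refine hv.resolve_left ?_
  rw [ENNReal.ofReal_eq_zero, not_le]
  exact Real.two_pi_pos

theorem ae_pt_not_root {b : ℂ[X]} (hb : b ≠ 0) : ∀ᵐ t ∂arc, b.eval (pt t) ≠ 0 := by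
  have hfin : {t : Torus | b.eval (pt t) = 0}.Finite := by
    have h1 : {z : ℂ | b.eval z = 0}.Finite := by
      have := b.roots.toFinset.finite_toSet
      refine this.subset ?_
      intro z hz
      simpa [hb] using hz
    exact h1.preimage pt_injective.injOn
  rw [ae_iff]
  have h0 : arc {t : Torus | b.eval (pt t) = 0} = 0 := by
    rw [← Set.biUnion_of_singleton {t : Torus | b.eval (pt t) = 0},
      measure_biUnion_null_iff hfin.countable]
    exact fun t _ => arc_singleton t
  simpa using h0

/-- An integrable function on the circle all of whose Fourier coefficients vanish is zero a.e. -/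
theorem ae_eq_zero_of_fourierCoeff_eq_zero {f : Torus → ℂ} (hf : Integrable f arc)
    (h : ∀ n : ℤ, fourierCoeff f n = 0) : f =ᵐ[arc] 0 := by
  have hint : ∀ φ : C(Torus, ℂ), Integrable (fun t => φ t * f t) arc := by
    intro φ
    refine hf.bdd_mul (c := ‖φ‖) φ.continuous.aestronglyMeasurable ?_
    exact Filter.Eventually.of_forall fun t => φ.norm_coe_le_norm t
  have hcont : ∀ φ : C(Torus, ℂ), ∫ t, φ t * f t ∂arc = 0 := by
    have hlin : ∀ φ ∈ Submodule.span ℂ (Set.range (fourier (T := 2 * Real.pi))),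
        ∫ t, φ t * f t ∂arc = 0 := by
      intro φ hφ
      induction hφ using Submodule.span_induction with
      | mem x hx =>
        obtain ⟨n, rfl⟩ := hx
        have := h (-n)
        simpa [fourierCoeff] using this
      | zero => simp
      | add x y _ _ hx hy =>
        simp only [ContinuousMap.add_apply, add_mul]
        rw [integral_add (hint x) (hint y), hx, hy, add_zero]
      | smul a x _ hx =>
        simp only [ContinuousMap.smul_apply, smul_eq_mul, mul_assoc]
        rw [integral_const_mul, hx, mul_zero]
    have hclosed : IsClosed {φ : C(Torus, ℂ) | ∫ t, φ t * f t ∂arc = 0} := by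
      have hc : Continuous fun φ : C(Torus, ℂ) => ∫ t, φ t * f t ∂arc := by
        refine (LipschitzWith.of_dist_le_mul (K := (∫ t, ‖f t‖ ∂arc).toNNReal) ?_).continuous
        intro φ ψ
        rw [Real.coe_toNNReal _ (integral_nonneg fun t => norm_nonneg _), dist_eq_norm,
          ← integral_sub (hint φ) (hint ψ), dist_eq_norm, ← integral_mul_const]
        refine norm_integral_le_of_norm_le (hf.norm.mul_const _) ?_
        refine Filter.Eventually.of_forall fun t => ?_
        rw [← sub_mul, norm_mul, mul_comm]
        gcongr
        exact (φ - ψ).norm_coe_le_norm t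
      exact isClosed_eq hc continuous_const
    intro φ
    have hmem : φ ∈ (Submodule.span ℂ
        (Set.range (fourier (T := 2 * Real.pi)))).topologicalClosure := by
      rw [span_fourier_closure_eq_top]; trivial
    exact closure_minimal (s := ((Submodule.span ℂ
        (Set.range (fourier (T := 2 * Real.pi)))) : Set C(Torus, ℂ))) hlin hclosed hmem
  refine ae_eq_zero_of_forall_setIntegral_isClosed_eq_zero hf ?_
  intro F hF
  rw [← integral_indicator hF.measurableSet]
  have hlim : Filter.Tendsto (fun n : ℕ => ∫ t, ((hF.apprSeq n t : ℝ) : ℂ) * f t ∂arc)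
      Filter.atTop (nhds (∫ t, F.indicator f t ∂arc)) := by
    refine tendsto_integral_of_dominated_convergence (fun t => ‖f t‖) ?_ hf.norm ?_ ?_
    · intro n
      refine AEStronglyMeasurable.mul ?_ hf.aestronglyMeasurable
      exact Continuous.aestronglyMeasurable (by fun_prop)
    · intro n
      refine Filter.Eventually.of_forall fun t => ?_
      rw [norm_mul]
      refine mul_le_of_le_one_left (norm_nonneg _) ?_
      have h1 := HasOuterApproxClosed.apprSeq_apply_le_one hF n t
      simp only [Complex.norm_real, NNReal.norm_eq]
      exact_mod_cast h1
    · refine Filter.Eventually.of_forall fun t => ?_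
      have h1 := (tendsto_pi_nhds.1 (HasOuterApproxClosed.tendsto_apprSeq hF)) t
      have h2 : Filter.Tendsto (fun n => ((hF.apprSeq n t : ℝ) : ℂ)) Filter.atTop
          (nhds (((F.indicator (fun _ => (1 : NNReal)) t : NNReal) : ℝ) : ℂ)) :=
        (Complex.continuous_ofReal.tendsto _).comp ((NNReal.continuous_coe.tendsto _).comp h1)
      have h3 := h2.mul_const (f t)
      convert h3 using 2
      by_cases ht : t ∈ F <;> simp [ht]
  have hz : ∀ n : ℕ, ∫ t, ((hF.apprSeq n t : ℝ) : ℂ) * f t ∂arc = 0 := by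
    intro n
    exact hcont ⟨fun t => ((hF.apprSeq n t : ℝ) : ℂ), by fun_prop⟩
  simp only [hz] at hlim
  exact (tendsto_nhds_unique hlim tendsto_const_nhds)

/-! ### The Hardy space -/

theorem integrable_Lp {p : ℝ≥0∞} [Fact (1 ≤ p)] (f : Lp ℂ p arc) : Integrable f arc :=
  (Lp.memLp f).integrable Fact.out

theorem fourierCoeff_congr {f g : Torus → ℂ} (h : f =ᵐ[arc] g) (n : ℤ) :
    fourierCoeff f n = fourierCoeff g n := by
  refine integral_congr_ae ?_
  filter_upwards [h] with t ht
  simp [ht]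

theorem fourierCoeff_Lp_add {p : ℝ≥0∞} [Fact (1 ≤ p)] (f g : Lp ℂ p arc) (n : ℤ) :
    fourierCoeff (f + g : Lp ℂ p arc) n = fourierCoeff f n + fourierCoeff g n := by
  rw [fourierCoeff_congr (Lp.coeFn_add f g)]
  exact congrFun (fourierCoeff.add (integrable_Lp f) (integrable_Lp g)) n

theorem fourierCoeff_Lp_smul {p : ℝ≥0∞} [Fact (1 ≤ p)] (c : ℂ) (f : Lp ℂ p arc) (n : ℤ) :
    fourierCoeff (c • f : Lp ℂ p arc) n = c * fourierCoeff f n := by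
  rw [fourierCoeff_congr (Lp.coeFn_smul c f)]
  exact fourierCoeff.const_smul _ _ _

theorem fourierCoeff_Lp_zero {p : ℝ≥0∞} (n : ℤ) :
    fourierCoeff (0 : Lp ℂ p arc) n = 0 := by
  rw [fourierCoeff_congr (Lp.coeFn_zero ℂ p arc)]
  simp [fourierCoeff]

/-- The Hardy space `H^p`, as the subspace of those functions in `L^p` of the unit circle whose
Fourier coefficients of negative index vanish (boundary values). -/
noncomputable def Hardy (p : ℝ≥0∞) [Fact (1 ≤ p)] : Submodule ℂ (Lp ℂ p arc) where
  carrier := {f | ∀ n : ℤ, n < 0 → fourierCoeff f n = 0}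
  add_mem' := by
    intro f g hf hg n hn
    rw [fourierCoeff_Lp_add, hf n hn, hg n hn, add_zero]
  zero_mem' := fun n _ => fourierCoeff_Lp_zero n
  smul_mem' := by
    intro c f hf n hn
    rw [fourierCoeff_Lp_smul, hf n hn, mul_zero]

/-- The pairing `⟨f, g⟩ = (1 / 2π) ∫ f \bar g` between `H^p` and `H^{p'}`. -/
noncomputable def pairing {p p' : ℝ≥0∞} [Fact (1 ≤ p)] [Fact (1 ≤ p')]
    (f : Hardy p) (g : Hardy p') : ℂ :=
  ∫ t, (f : Lp ℂ p arc) t * (starRingEnd ℂ) ((g : Lp ℂ p' arc) t) ∂arc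

theorem integrable_pairing {p p' : ℝ≥0∞} [Fact (1 ≤ p)] [Fact (1 ≤ p')]
    [ENNReal.HolderConjugate p p'] (f : Hardy p) (g : Hardy p') :
    Integrable (fun t => (f : Lp ℂ p arc) t * (starRingEnd ℂ) ((g : Lp ℂ p' arc) t)) arc :=
  (Lp.memLp (f : Lp ℂ p arc)).integrable_mul (Lp.memLp (g : Lp ℂ p' arc)).star

/-- `h` is the Riesz projection of `f`: the element of `H^p` with the same Fourier coefficients
of non-negative index as `f`. It is unique, and for `1 < p < ∞` it exists for every `f ∈ L^p`. -/
def IsRieszProj {p : ℝ≥0∞} [Fact (1 ≤ p)] (f : Lp ℂ p arc) (h : Hardy p) : Prop :=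
  ∀ n : ℤ, 0 ≤ n → fourierCoeff (h : Lp ℂ p arc) n = fourierCoeff f n

/-! ### Multiplication by polynomials on the Hardy space -/

theorem exists_bound (a : ℂ[X]) : ∃ C : ℝ, ∀ t : Torus, ‖a.eval (pt t)‖ ≤ C := by
  have hc : Continuous fun t : Torus => a.eval (pt t) := a.continuous.comp continuous_pt
  obtain ⟨C, hC⟩ := isCompact_univ.exists_bound_of_continuousOn hc.continuousOn
  exact ⟨C, fun t => hC t trivial⟩

theorem memLp_polyMul {p : ℝ≥0∞} (a : ℂ[X]) (f : Lp ℂ p arc) :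
    MemLp (fun t => a.eval (pt t) * f t) p arc := by
  obtain ⟨C, hC⟩ := exists_bound a
  refine MemLp.of_le_mul (c := C) (Lp.memLp f) ?_ ?_
  · exact (a.continuous.comp continuous_pt).aestronglyMeasurable.mul
      (Lp.memLp f).aestronglyMeasurable
  · refine Filter.Eventually.of_forall fun t => ?_
    rw [norm_mul]
    exact mul_le_mul_of_nonneg_right (hC t) (norm_nonneg _)

theorem fourierCoeff_polyMul {p : ℝ≥0∞} [Fact (1 ≤ p)] (a : ℂ[X]) (f : Lp ℂ p arc) (n : ℤ) :
    fourierCoeff (fun t => a.eval (pt t) * f t) n =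
      a.sum fun k c => c * fourierCoeff f (n - k) := by
  have hpow : ∀ (k : ℕ) (t : Torus), pt t ^ k = fourier (k : ℤ) t := by
    intro k t
    simp [pt, fourier_apply, AddCircle.toCircle_nsmul]
  simp only [fourierCoeff, Polynomial.sum, Polynomial.eval_eq_sum, hpow]
  simp_rw [← integral_const_mul]
  rw [← integral_finsetSum]
  · refine integral_congr_ae (Filter.Eventually.of_forall fun t => ?_)
    simp only [smul_eq_mul, Finset.sum_mul, Finset.mul_sum]
    refine Finset.sum_congr rfl fun k _ => ?_
    have : fourier (-(n - k)) t = fourier (-n) t * fourier (k : ℤ) t := by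
      rw [← fourier_add, show -(n - (k : ℤ)) = -n + k by ring]
    rw [this]; ring
  · intro k _
    exact (integrable_Lp f).fourier_smul _ |>.const_mul _

/-- Multiplication by the polynomial `a` on `H^p`. -/
noncomputable def polyMul {p : ℝ≥0∞} [Fact (1 ≤ p)] (a : ℂ[X]) (v : Hardy p) : Hardy p :=
  ⟨(memLp_polyMul a (v : Lp ℂ p arc)).toLp, by
    intro n hn
    rw [fourierCoeff_congr (memLp_polyMul a (v : Lp ℂ p arc)).coeFn_toLp, fourierCoeff_polyMul]
    refine Finset.sum_eq_zero fun k _ => ?_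
    simp only [v.2 (n - k) (by omega), mul_zero]⟩

/-! ### Rational functions -/

/-- The polynomial `r^♯(z) = z ^ k * conj (r (1 / conj z))`, `k = deg r`, that is, the polynomial
with the conjugated coefficients of `r` in reverse order. -/
noncomputable def sharp (r : ℂ[X]) : ℂ[X] := (r.map (starRingEnd ℂ)).reverse

/-- Rational functions with poles only on the unit circle. -/
def RatT : Set (RatFunc ℂ) := {ω | ∀ z : ℂ, ω.denom.IsRoot z → ‖z‖ = 1}

/-- Strictly proper rational functions with poles only on the unit circle. -/
def RatT0 : Set (RatFunc ℂ) := {ρ | ρ ∈ RatT ∧ ρ.num.degree < ρ.denom.degree}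

/-- The values of the rational function `ω` on the unit circle. -/
noncomputable def onCircle (ω : RatFunc ℂ) (t : Torus) : ℂ := ω.eval (RingHom.id ℂ) (pt t)

theorem aestronglyMeasurable_onCircle (ω : RatFunc ℂ) : AEStronglyMeasurable (onCircle ω) arc := by
  have h : ∀ a : ℂ[X], Measurable fun t : Torus => a.eval (pt t) := fun a =>
    (a.continuous.comp continuous_pt).measurable
  exact ((h ω.num).div (h ω.denom)).aestronglyMeasurable

/-- The class modulo a.e. equality of the function `ω` on the unit circle. -/
noncomputable def circleClass (ω : RatFunc ℂ) : Torus →ₘ[arc] ℂ :=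
  AEEqFun.mk (onCircle ω) (aestronglyMeasurable_onCircle ω)

/-- The rational function `ω^*` with `ω^*(z) = conj (ω z)` for `z` on the unit circle, that is,
`ω^*(z) = conj (ω (1 / conj z))`: numerator and denominator of `ω` are replaced by
`z ^ N * conj (a (1 / conj z))`, where `N` is the maximum of their degrees. -/
noncomputable def star (ω : RatFunc ℂ) : RatFunc ℂ :=
  let N := max ω.num.natDegree ω.denom.natDegree
  algebraMap ℂ[X] (RatFunc ℂ) ((ω.num.map (starRingEnd ℂ)).reflect N) /
    algebraMap ℂ[X] (RatFunc ℂ) ((ω.denom.map (starRingEnd ℂ)).reflect N)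

theorem eval_div_algebraMap (a b : ℂ[X]) (z : ℂ) (hb : b.eval z ≠ 0) :
    RatFunc.eval (RingHom.id ℂ) z (algebraMap ℂ[X] (RatFunc ℂ) a / algebraMap ℂ[X] (RatFunc ℂ) b) =
      a.eval z / b.eval z := by
  have hb0 : b ≠ 0 := by rintro rfl; simp at hb
  set x := algebraMap ℂ[X] (RatFunc ℂ) a / algebraMap ℂ[X] (RatFunc ℂ) b with hx
  have h1 : x.num * b = a * x.denom := (RatFunc.num_mul_eq_mul_denom_iff hb0).2 hx
  have hd : x.denom.eval z ≠ 0 := by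
    obtain ⟨c, hc⟩ := RatFunc.denom_div_dvd a b
    intro h0
    rw [← hx] at hc
    rw [hc, Polynomial.eval_mul, h0, zero_mul] at hb
    exact hb rfl
  have h2 := congrArg (Polynomial.eval z) h1
  simp only [Polynomial.eval_mul] at h2
  simp only [RatFunc.eval, Polynomial.eval₂_id]
  rw [div_eq_div_iff hd hb, h2]

theorem eval_map_conj_reflect (a : ℂ[X]) (N : ℕ) (hN : a.natDegree ≤ N) (t : Torus) :
    ((a.map (starRingEnd ℂ)).reflect N).eval (pt t) =
      pt t ^ N * (starRingEnd ℂ) (a.eval (pt t)) := by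
  have hz : pt t * (starRingEnd ℂ) (pt t) = 1 := by
    rw [Complex.mul_conj, Complex.normSq_eq_norm_sq, norm_pt]; simp
  let i : Invertible ((starRingEnd ℂ) (pt t)) := ⟨pt t, hz, by rw [mul_comm]; exact hz⟩
  have h := Polynomial.eval₂_reflect_mul_pow (RingHom.id ℂ) ((starRingEnd ℂ) (pt t)) N
    (a.map (starRingEnd ℂ)) (by simpa using hN)
  simp only [Polynomial.eval₂_id] at h
  have h' : ⅟((starRingEnd ℂ) (pt t)) = pt t := rfl
  rw [h', Polynomial.eval_map_apply] at h
  rw [← h, mul_comm, mul_assoc, ← mul_pow, mul_comm ((starRingEnd ℂ) (pt t)), hz, one_pow, mul_one]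

/-- `ω^*(z) = conj (ω z)` on the unit circle, outside the poles. -/
theorem onCircle_star (ω : RatFunc ℂ) (t : Torus) (ht : ω.denom.eval (pt t) ≠ 0) :
    onCircle (star ω) t = (starRingEnd ℂ) (onCircle ω t) := by
  have hp : pt t ≠ 0 := by
    intro h; have := norm_pt t; rw [h] at this; simp at this
  rw [onCircle, star]
  rw [eval_div_algebraMap]
  · rw [eval_map_conj_reflect _ _ (le_max_left _ _), eval_map_conj_reflect _ _ (le_max_right _ _),
      mul_div_mul_left _ _ (pow_ne_zero _ hp), ← map_div₀]
    simp [onCircle, RatFunc.eval]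
  · rw [eval_map_conj_reflect _ _ (le_max_right _ _)]
    exact mul_ne_zero (pow_ne_zero _ hp) (by simpa using ht)

theorem eval_denom_ne_zero_ae (ω : RatFunc ℂ) : ∀ᵐ t ∂arc, ω.denom.eval (pt t) ≠ 0 :=
  ae_pt_not_root ω.denom_ne_zero

theorem onCircle_add (ρ σ : RatFunc ℂ) :
    onCircle (ρ + σ) =ᵐ[arc] onCircle ρ + onCircle σ := by
  filter_upwards [eval_denom_ne_zero_ae ρ, eval_denom_ne_zero_ae σ] with t h1 h2
  exact RatFunc.eval_add (f := RingHom.id ℂ) (a := pt t) (by rwa [Polynomial.eval₂_id])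
    (by rwa [Polynomial.eval₂_id])

theorem onCircle_C_mul (c : ℂ) (ρ : RatFunc ℂ) :
    onCircle (RatFunc.C c * ρ) =ᵐ[arc] fun t => c * onCircle ρ t := by
  filter_upwards [eval_denom_ne_zero_ae ρ] with t h1
  rw [onCircle, RatFunc.eval_mul (f := RingHom.id ℂ) (a := pt t) (by simp)
    (by rwa [Polynomial.eval₂_id])]
  simp [onCircle]

theorem add_mem_RatT0 {ρ σ : RatFunc ℂ} (hρ : ρ ∈ RatT0) (hσ : σ ∈ RatT0) : ρ + σ ∈ RatT0 := by
  refine ⟨fun z hz => ?_, ?_⟩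
  · have h := hz.dvd (RatFunc.denom_add_dvd ρ σ)
    rcases Polynomial.root_mul.1 h with h | h
    · exact hρ.1 z h
    · exact hσ.1 z h
  · have h := congrArg Polynomial.degree (RatFunc.num_denom_add ρ σ)
    rw [Polynomial.degree_mul, Polynomial.degree_mul, Polynomial.degree_mul] at h
    have hd1 := Polynomial.degree_eq_natDegree ρ.denom_ne_zero
    have hd2 := Polynomial.degree_eq_natDegree σ.denom_ne_zero
    have hd3 := Polynomial.degree_eq_natDegree (ρ + σ).denom_ne_zero
    have hlt : (ρ.num * σ.denom + ρ.denom * σ.num).degree < ρ.denom.degree + σ.denom.degree := by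
      refine (Polynomial.degree_add_le _ _).trans_lt (max_lt ?_ ?_)
      · rw [Polynomial.degree_mul, hd2]
        exact WithBot.add_lt_add_right (by simp) hρ.2
      · rw [Polynomial.degree_mul, hd1]
        exact WithBot.add_lt_add_left (by simp) hσ.2
    by_contra hcon
    rw [not_lt] at hcon
    have h1 : (ρ.num * σ.denom + ρ.denom * σ.num).degree + (ρ + σ).denom.degree <
        ρ.denom.degree + σ.denom.degree + (ρ + σ).denom.degree := by
      rw [hd3]
      exact WithBot.add_lt_add_right (by simp) hlt
    rw [← h, add_comm] at h1
    exact absurd h1 (not_lt.2 (add_le_add le_rfl hcon))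

theorem C_mul_mem_RatT0 (c : ℂ) {ρ : RatFunc ℂ} (hρ : ρ ∈ RatT0) : RatFunc.C c * ρ ∈ RatT0 := by
  refine ⟨fun z hz => ?_, ?_⟩
  · have h := hz.dvd (RatFunc.denom_mul_dvd (RatFunc.C c) ρ)
    rw [RatFunc.denom_C, one_mul] at h
    exact hρ.1 z h
  · have h := congrArg Polynomial.degree (RatFunc.num_denom_mul (RatFunc.C c) ρ)
    rw [RatFunc.denom_C, RatFunc.num_C, one_mul] at h
    simp only [Polynomial.degree_mul] at h
    have hd1 := Polynomial.degree_eq_natDegree ρ.denom_ne_zero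
    have hd3 := Polynomial.degree_eq_natDegree (RatFunc.C c * ρ).denom_ne_zero
    by_contra hcon
    rw [not_lt] at hcon
    have h1 : (Polynomial.C c).degree + ρ.num.degree < ρ.denom.degree := by
      refine lt_of_le_of_lt ?_ hρ.2
      calc (Polynomial.C c).degree + ρ.num.degree ≤ 0 + ρ.num.degree :=
            add_le_add Polynomial.degree_C_le le_rfl
        _ = _ := zero_add _
    have h2 : (Polynomial.C c).degree + ρ.num.degree + (RatFunc.C c * ρ).denom.degree <
        ρ.denom.degree + (RatFunc.C c * ρ).denom.degree := by
      rw [hd3]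
      exact WithBot.add_lt_add_right (by simp) h1
    rw [← h, add_comm] at h2
    exact absurd h2 (not_lt.2 (add_le_add le_rfl hcon))

theorem zero_mem_RatT0 : (0 : RatFunc ℂ) ∈ RatT0 := by
  simp [RatT0, RatT]

/-- `1 / (z - α)` is not integrable over the unit circle when `α` lies on it. -/
theorem not_integrable_inv_sub {α : ℂ} (hα : ‖α‖ = 1) :
    ¬ Integrable (fun t : Torus => (pt t - α)⁻¹) arc := by
  intro h
  have hv : Integrable (fun t : Torus => (pt t - α)⁻¹) (volume : Measure Torus) := by
    rw [AddCircle.volume_eq_smul_haarAddCircle]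
    exact h.smul_measure ENNReal.ofReal_ne_top
  have h2 := (AddCircle.measurePreserving_mk (2 * Real.pi) 0).integrable_comp_of_integrable hv
  have h3 : CircleIntegrable (fun z => (z - α) ^ (-1 : ℤ)) 0 1 := by
    rw [CircleIntegrable, intervalIntegrable_iff, Set.uIoc_of_le Real.two_pi_pos.le]
    rw [zero_add] at h2
    refine h2.congr (Filter.Eventually.of_forall fun θ => ?_)
    simp only [Function.comp, zpow_neg_one]
    rw [← pt_coe]
  rw [circleIntegrable_sub_zpow_iff] at h3
  simp [hα] at h3

theorem num_eq_zero_of_integrable (n : ℕ) : ∀ a b : ℂ[X], b.natDegree = n → b ≠ 0 →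
    a.degree < b.degree → (∀ z, b.IsRoot z → ‖z‖ = 1) →
    Integrable (fun t : Torus => a.eval (pt t) / b.eval (pt t)) arc → a = 0 := by
  induction n with
  | zero =>
    intro a b hn hb hab _ _
    rw [Polynomial.degree_eq_natDegree hb, hn] at hab
    exact Polynomial.degree_lt_iff_coeff_zero a 0 |>.1 (by simpa using hab) |> fun h =>
      Polynomial.ext fun k => by simpa using h k (Nat.zero_le k)
  | succ n ih =>
    intro a b hn hb hab hroot hint
    obtain ⟨α, hα⟩ : ∃ α, b.IsRoot α :=
      IsAlgClosed.exists_root b (by rw [Polynomial.degree_eq_natDegree hb, hn]; exact_mod_cast n.succ_ne_zero)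
    have hα1 := hroot α hα
    obtain ⟨c, rfl⟩ := Polynomial.dvd_iff_isRoot.2 hα
    have hc : c ≠ 0 := right_ne_zero_of_mul hb
    have hXα : (Polynomial.X - Polynomial.C α) ≠ 0 := Polynomial.X_sub_C_ne_zero α
    have hae := ae_pt_not_root hb
    -- the numerator vanishes at the pole
    have hroot' : a.IsRoot α := by
      by_contra hne
      obtain ⟨C, hC⟩ := exists_bound c
      have h1 : Integrable (fun t : Torus => a.eval (pt t) / (pt t - α)) arc := by
        have := hint.bdd_mul (c := C) (f := fun t : Torus => c.eval (pt t))
          (c.continuous.comp continuous_pt).aestronglyMeasurable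
          (Filter.Eventually.of_forall hC)
        refine this.congr ?_
        filter_upwards [hae] with t ht
        simp only [Polynomial.eval_mul, Polynomial.eval_sub, Polynomial.eval_X,
          Polynomial.eval_C, mul_ne_zero_iff] at ht ⊢
        have h1 := ht.1
        have h2 := ht.2
        field_simp
      obtain ⟨d, hd⟩ : ∃ d : ℂ[X], a = (Polynomial.X - Polynomial.C α) * d +
          Polynomial.C (a.eval α) := by
        have hdvd : (Polynomial.X - Polynomial.C α) ∣ a - Polynomial.C (a.eval α) :=
          Polynomial.dvd_iff_isRoot.2 (by simp)
        obtain ⟨d, hd⟩ := hdvd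
        exact ⟨d, by rw [← hd]; ring⟩
      have h2 : Integrable (fun t : Torus => d.eval (pt t)) arc := by
        obtain ⟨D, hD⟩ := exists_bound d
        exact Integrable.of_bound (d.continuous.comp continuous_pt).aestronglyMeasurable D
          (Filter.Eventually.of_forall hD)
      have h3 := (h1.sub h2).const_mul (a.eval α)⁻¹
      refine not_integrable_inv_sub hα1 (h3.congr ?_)
      filter_upwards [hae] with t ht
      simp only [Polynomial.eval_mul, Polynomial.eval_sub, Polynomial.eval_X,
        Polynomial.eval_C, mul_ne_zero_iff] at ht
      have h4 := ht.1
      have h5 : a.eval (pt t) = (pt t - α) * d.eval (pt t) + a.eval α := by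
        conv_lhs => rw [hd]
        simp
      have h6 : a.eval α ≠ 0 := hne
      simp only [Pi.sub_apply]
      rw [h5]
      field_simp
      ring
    obtain ⟨e, rfl⟩ := Polynomial.dvd_iff_isRoot.2 hroot'
    have he : e = 0 := by
      refine ih e c ?_ hc ?_ (fun z hz => hroot z ?_) ?_
      · rw [Polynomial.natDegree_mul hXα hc, Polynomial.natDegree_X_sub_C] at hn
        omega
      · rw [Polynomial.degree_mul, Polynomial.degree_mul] at hab
        exact lt_of_add_lt_add_left hab
      · exact Polynomial.root_mul.2 (Or.inr hz)
      · refine hint.congr ?_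
        filter_upwards [hae] with t ht
        simp only [Polynomial.eval_mul, Polynomial.eval_sub, Polynomial.eval_X,
          Polynomial.eval_C, mul_ne_zero_iff] at ht ⊢
        exact mul_div_mul_left _ _ ht.1
    rw [he, mul_zero]

/-- A strictly proper rational function with poles on the circle that is integrable over the
circle is zero. -/
theorem eq_zero_of_mem_RatT0_of_integrable {ρ : RatFunc ℂ} (hρ : ρ ∈ RatT0)
    (hint : Integrable (onCircle ρ) arc) : ρ = 0 := by
  refine RatFunc.num_eq_zero_iff.1
    (num_eq_zero_of_integrable _ ρ.num ρ.denom rfl ρ.denom_ne_zero hρ.2 hρ.1 ?_)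
  have h : onCircle ρ = fun t => ρ.num.eval (pt t) / ρ.denom.eval (pt t) := by
    funext t
    rw [onCircle, RatFunc.eval, Polynomial.eval₂_id, Polynomial.eval₂_id]
  rwa [← h]

/-! ### The Toeplitz-like operator and its adjoint -/

/-- The graph of `T_ω`: the pairs `(g, h)` with `ω g = f + ρ` for some `f ∈ L^p` with Riesz
projection `h` and some strictly proper `ρ` with poles only on the circle. -/
noncomputable def toeplitzGraph (p : ℝ≥0∞) [Fact (1 ≤ p)] (ω : RatFunc ℂ) :
    Submodule ℂ (Hardy p × Hardy p) where
  carrier := {x | ∃ f : Lp ℂ p arc, ∃ ρ ∈ RatT0,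
    (∀ᵐ t ∂arc, onCircle ω t * (x.1 : Lp ℂ p arc) t = f t + onCircle ρ t) ∧ IsRieszProj f x.2}
  add_mem' := by
    rintro x y ⟨f, ρ, hρ, hf, hx⟩ ⟨f', ρ', hρ', hf', hy⟩
    refine ⟨f + f', ρ + ρ', add_mem_RatT0 hρ hρ', ?_, ?_⟩
    · filter_upwards [hf, hf', Lp.coeFn_add f f', onCircle_add ρ ρ',
        Lp.coeFn_add (x.1 : Lp ℂ p arc) (y.1 : Lp ℂ p arc)] with t h1 h2 h3 h4 h5
      have h6 : (((x + y).1 : Hardy p) : Lp ℂ p arc) t =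
          (x.1 : Lp ℂ p arc) t + (y.1 : Lp ℂ p arc) t := h5
      rw [h6, h3, h4, Pi.add_apply, Pi.add_apply, mul_add, h1, h2]
      ring
    · intro n hn
      rw [fourierCoeff_Lp_add, ← hx n hn, ← hy n hn, ← fourierCoeff_Lp_add]
      rfl
  zero_mem' := by
    refine ⟨0, 0, zero_mem_RatT0, ?_, ?_⟩
    · filter_upwards [Lp.coeFn_zero ℂ p arc] with t ht
      have h6 : (((0 : Hardy p × Hardy p).1 : Hardy p) : Lp ℂ p arc) t = 0 := ht
      rw [h6, ht]
      simp [onCircle]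
    · intro n _
      rfl
  smul_mem' := by
    rintro c x ⟨f, ρ, hρ, hf, hx⟩
    refine ⟨c • f, RatFunc.C c * ρ, C_mul_mem_RatT0 c hρ, ?_, ?_⟩
    · filter_upwards [hf, Lp.coeFn_smul c f, onCircle_C_mul c ρ,
        Lp.coeFn_smul c (x.1 : Lp ℂ p arc)] with t h1 h3 h4 h5
      have h6 : (((c • x).1 : Hardy p) : Lp ℂ p arc) t = c * (x.1 : Lp ℂ p arc) t := h5
      rw [h6, h3, h4, Pi.smul_apply, smul_eq_mul, mul_left_comm, h1]
      ring
    · intro n hn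
      rw [fourierCoeff_Lp_smul, ← hx n hn, ← fourierCoeff_Lp_smul]
      rfl

theorem toeplitzGraph_single_valued (p : ℝ≥0∞) [Fact (1 ≤ p)] (ω : RatFunc ℂ) :
    ∀ x ∈ toeplitzGraph p ω, x.1 = 0 → x.2 = 0 := by
  rintro ⟨g, h⟩ ⟨f, ρ, hρ, hf, hh⟩ hg
  simp only at hg hh hf ⊢
  subst hg
  have h0 : ∀ᵐ t ∂arc, (0 : ℂ) = f t + onCircle ρ t := by
    filter_upwards [hf, Lp.coeFn_zero ℂ p arc] with t h1 h2
    have h6 : ((0 : Hardy p) : Lp ℂ p arc) t = 0 := h2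
    rw [← h1, h6, mul_zero]
  have hρ0 : ρ = 0 := by
    refine eq_zero_of_mem_RatT0_of_integrable hρ ((integrable_Lp f).neg.congr ?_)
    filter_upwards [h0] with t ht
    rw [Pi.neg_apply]
    linear_combination ht
  have hf0 : (f : Torus → ℂ) =ᵐ[arc] (0 : Lp ℂ p arc) := by
    filter_upwards [h0, Lp.coeFn_zero ℂ p arc] with t ht h2
    have h3 : onCircle ρ t = 0 := by simp [onCircle, hρ0]
    rw [h2, Pi.zero_apply]
    rw [h3, add_zero] at ht
    exact ht.symm
  have hcoef : ∀ n : ℤ, fourierCoeff (h : Lp ℂ p arc) n = 0 := by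
    intro n
    rcases lt_or_ge n 0 with hn | hn
    · exact h.2 n hn
    · rw [hh n hn, fourierCoeff_congr hf0, fourierCoeff_Lp_zero]
  have := ae_eq_zero_of_fourierCoeff_eq_zero (integrable_Lp (h : Lp ℂ p arc)) hcoef
  exact Subtype.ext (Lp.eq_zero_iff_ae_eq_zero.2 this)

/-- The Toeplitz-like operator `T_ω (H^p → H^p)` with rational symbol `ω`. -/
noncomputable def toeplitz (p : ℝ≥0∞) [Fact (1 ≤ p)] (ω : RatFunc ℂ) : Hardy p →ₗ.[ℂ] Hardy p :=
  (toeplitzGraph p ω).toLinearPMap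

theorem graph_toeplitz (p : ℝ≥0∞) [Fact (1 ≤ p)] (ω : RatFunc ℂ) :
    (toeplitz p ω).graph = toeplitzGraph p ω :=
  Submodule.toLinearPMap_graph_eq _ (toeplitzGraph_single_valued p ω)

/-- The adjoint relation of `T (H^p → H^p)` in `H^{p'} × H^{p'}`: the pairs `(g, k)` with
`⟨T f, g⟩ = ⟨f, k⟩` for all `f` in the domain of `T`. -/
noncomputable def adjointGraph {p p' : ℝ≥0∞} [Fact (1 ≤ p)] [Fact (1 ≤ p')]
    [ENNReal.HolderConjugate p p'] (T : Hardy p →ₗ.[ℂ] Hardy p) :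
    Submodule ℂ (Hardy p' × Hardy p') where
  carrier := {x | ∀ f : T.domain, pairing (T f) x.1 = pairing (f : Hardy p) x.2}
  add_mem' := by
    intro x y hx hy f
    have key : ∀ (u : Hardy p) (v w : Hardy p'),
        pairing u (v + w) = pairing u v + pairing u w := by
      intro u v w
      rw [pairing, pairing, pairing, ← integral_add (integrable_pairing u v)
        (integrable_pairing u w)]
      refine integral_congr_ae ?_
      filter_upwards [Lp.coeFn_add (v : Lp ℂ p' arc) (w : Lp ℂ p' arc)] with t ht
      have h6 : ((v + w : Hardy p') : Lp ℂ p' arc) t =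
          (v : Lp ℂ p' arc) t + (w : Lp ℂ p' arc) t := ht
      rw [h6, map_add, mul_add]
    rw [Prod.fst_add, Prod.snd_add, key, key, hx f, hy f]
  zero_mem' := by
    intro f
    have key : ∀ u : Hardy p, pairing u (0 : Hardy p') = 0 := by
      intro u
      rw [pairing, ← integral_zero Torus ℂ (μ := arc)]
      refine integral_congr_ae ?_
      filter_upwards [Lp.coeFn_zero ℂ p' arc] with t ht
      have h6 : ((0 : Hardy p') : Lp ℂ p' arc) t = 0 := ht
      rw [h6, map_zero, mul_zero]
    rw [Prod.fst_zero, Prod.snd_zero, key, key]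
  smul_mem' := by
    intro c x hx f
    have key : ∀ (u : Hardy p) (v : Hardy p'),
        pairing u (c • v) = (starRingEnd ℂ) c * pairing u v := by
      intro u v
      rw [pairing, pairing, ← integral_const_mul]
      refine integral_congr_ae ?_
      filter_upwards [Lp.coeFn_smul c (v : Lp ℂ p' arc)] with t ht
      have h6 : ((c • v : Hardy p') : Lp ℂ p' arc) t = c * (v : Lp ℂ p' arc) t := ht
      rw [h6, map_mul]
      ring
    rw [Prod.smul_fst, Prod.smul_snd, key, key, hx f]

/-- The adjoint `T^* (H^{p'} → H^{p'})` of `T (H^p → H^p)` with respect to the pairing. Its graph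
is `adjointGraph T` as soon as that relation is single-valued. -/
noncomputable def adjoint (p p' : ℝ≥0∞) [Fact (1 ≤ p)] [Fact (1 ≤ p')]
    [ENNReal.HolderConjugate p p'] (T : Hardy p →ₗ.[ℂ] Hardy p) : Hardy p' →ₗ.[ℂ] Hardy p' :=
  (adjointGraph T).toLinearPMap

/-- The kernel of a partially defined operator, as a subspace of the ambient space. -/
noncomputable def kernel {p : ℝ≥0∞} [Fact (1 ≤ p)] (A : Hardy p →ₗ.[ℂ] Hardy p) :
    Submodule ℂ (Hardy p) := (LinearMap.ker A.toFun).map A.domain.subtype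

/-! ### Counting zeros and poles with multiplicity -/

open Classical in
/-- Number of zeros of `ω` in the open unit disc, with multiplicity (for `ω ≠ 0`). -/
noncomputable def zerosInside (ω : RatFunc ℂ) : ℕ := ω.num.roots.countP fun z => ‖z‖ < 1

open Classical in
/-- Number of zeros of `ω` in `{|z| > 1} ∪ {∞}`, with multiplicity (for `ω ≠ 0`); the second
summand is the order of the zero at infinity. -/
noncomputable def zerosOutside (ω : RatFunc ℂ) : ℕ :=
  ω.num.roots.countP (fun z => 1 < ‖z‖) + (ω.denom.natDegree - ω.num.natDegree)

open Classical in
/-- Number of poles of `ω` on the unit circle, with multiplicity. -/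
noncomputable def polesOnCircle (ω : RatFunc ℂ) : ℕ := ω.denom.roots.countP fun z => ‖z‖ = 1

end ToeplitzLike

namespace ToeplitzLike

/-! ### Fourier coefficients and division by linear factors -/

/-! Clearing denominators turns the unbounded operator into algebra over ℂ[X]: (f, h) lies in the
graph of T_ω iff s f = q h + r for a polynomial r with deg r < deg q (`mem_toeplitzGraph_of_eq`,
`exists_of_mem_toeplitzGraph`). This rests on two facts: an integrable, strictly proper rational
function with poles on the circle vanishes, and division by a polynomial without roots in the open
disc creates no negative frequencies (`fourierCoeff_neg_eq_zero_of_polyMul`). The second follows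
from a two-term recurrence and the decay of Fourier coefficients.

Put m = deg q, n = deg s. On the circle z^m conj(q) = q^♯, so polynomials cross the pairing as their
sharps. Hence q^♯ v is related to k by the adjoint whenever z^m s^♯ v = z^n k + c with deg c < n
(`mem_adjointGraph_of_eq`); r and c disappear by orthogonality. Such a k exists for every v, since
only finitely many coefficients must be removed (`exists_backward_shift`).

Conversely (`mem_adjointGraph_toeplitz_iff`), a pair (u, k) of the adjoint relation need only be
tested on polynomials. Multiples of q show that z^m s^♯ u - z^n q^♯ k is a polynomial, and Bézout
for the coprime polynomials z^m s^♯ and q^♯ gives u = q^♯ v + τ with deg τ < m. Subtracting the pair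
built from v leaves τ in the domain. Its image is again a polynomial, and a test polynomial
vanishing to high order at 0, with image congruent to τ modulo z^m, yields ⟨τ, τ⟩ = 0
(`eq_zero_of_ofPoly_mem_adjointGraph`).

For the kernel, z^m s^♯ v = c. Split s = a b with the roots of a inside the disc and those of b not.
All roots of z^m b^♯ lie in the closed disc, so dividing by it lowers the top frequency by m + deg b
(`fourierCoeff_ge_eq_zero_of_polyMul`): a^♯ v is a polynomial of degree less than deg a - m, and 1 /
a^♯ is in the Hardy space. Reflecting roots in the circle turns deg a into the count of zeros of ω^*
outside, where roots of a at 0 become zeros at infinity. -/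

theorem tendsto_fourierCoeff_cofinite (f : Torus → ℂ) :
    Filter.Tendsto (fourierCoeff f) Filter.cofinite (nhds 0) := by
  -- Riemann–Lebesgue on ℝ for f cut off to one period; up to the factor 1 / 2π, the n-th Fourier
  -- coefficient is the Fourier transform at n / 2π.
  have h := Real.tendsto_integral_exp_smul_cocompact
    ((Set.Ioc 0 (2 * Real.pi)).indicator fun x : ℝ => f (x : Torus))
  have hpi : (2 * Real.pi) ≠ 0 := Real.two_pi_pos.ne'
  have hscale : Filter.Tendsto (fun n : ℤ => (n : ℝ) * (2 * Real.pi)⁻¹) Filter.cofinite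
      (Filter.cocompact ℝ) :=
    (Filter.tendsto_cocompact_mul_right₀ (inv_ne_zero hpi)).comp Int.tendsto_coe_cofinite
  have h2 := (h.comp hscale).const_smul (1 / (2 * Real.pi))
  rw [smul_zero] at h2
  refine h2.congr fun n => ?_
  rw [fourierCoeff_eq_intervalIntegral f n 0, zero_add, Function.comp_apply,
    intervalIntegral.integral_of_le Real.two_pi_pos.le, ← integral_indicator measurableSet_Ioc]
  congr 1
  refine integral_congr_ae (Filter.Eventually.of_forall fun x => ?_)
  by_cases hx : x ∈ Set.Ioc 0 (2 * Real.pi)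
  · simp only [Set.indicator_of_mem hx, Circle.smul_def, Real.fourierChar_apply,
      fourier_coe_apply, smul_eq_mul]
    congr 2
    have h3 : (Real.pi : ℂ) ≠ 0 := by exact_mod_cast Real.pi_ne_zero
    push_cast
    field_simp
  · simp only [Set.indicator_of_notMem hx, smul_zero]

theorem fourierCoeff_X_sub_C_mul {p : ℝ≥0∞} [Fact (1 ≤ p)] (f : Lp ℂ p arc) (β : ℂ) (n : ℤ) :
    fourierCoeff (fun t => (X - C β : ℂ[X]).eval (pt t) * f t) n =
      fourierCoeff f (n - 1) - β * fourierCoeff f n := by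
  rw [fourierCoeff_polyMul, sub_eq_add_neg, ← C_neg, Polynomial.sum_add_index _ _ _ (by simp)
    (by intros; ring), Polynomial.sum_X_index (by simp), Polynomial.sum_C_index (by simp)]
  simp
  ring

/-- The moduli cannot decrease as the index runs to -∞, yet they tend to zero. Decay, not mere
boundedness, is what admits ‖β‖ = 1, a root on the circle. -/
theorem eq_zero_of_recurrence_neg {a : ℤ → ℂ} (ha : Filter.Tendsto a Filter.cofinite (nhds 0))
    {β : ℂ} (hβ : 1 ≤ ‖β‖) (h : ∀ n < 0, a (n - 1) = β * a n) : ∀ n < 0, a n = 0 := by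
  intro n hn
  have hle : ∀ j : ℕ, ‖a n‖ ≤ ‖a (n - j)‖ := by
    intro j
    induction j with
    | zero => simp
    | succ j ih =>
      refine ih.trans ?_
      rw [show n - ((j + 1 : ℕ) : ℤ) = n - j - 1 by push_cast; ring, h _ (by omega), norm_mul]
      exact le_mul_of_one_le_left (norm_nonneg _) hβ
  have hinj : Function.Injective fun j : ℕ => n - (j : ℤ) := fun i j hij => by
    simp only at hij; omega
  have hlim := (ha.comp hinj.tendsto_cofinite).norm
  rw [Nat.cofinite_eq_atTop, norm_zero] at hlim
  exact norm_le_zero_iff.1 (ge_of_tendsto' hlim hle)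

/-- Mirror image towards +∞. The recurrence at n = N already reaches a (N - 1), which is the gain of
one index per linear factor. -/
theorem eq_zero_of_recurrence_ge {a : ℤ → ℂ} (ha : Filter.Tendsto a Filter.cofinite (nhds 0))
    {β : ℂ} (hβ : ‖β‖ ≤ 1) {N : ℤ} (h : ∀ n, N ≤ n → a (n - 1) = β * a n) :
    ∀ n, N - 1 ≤ n → a n = 0 := by
  intro n hn
  have hle : ∀ j : ℕ, ‖a n‖ ≤ ‖a (n + j)‖ := by
    intro j
    induction j with
    | zero => simp
    | succ j ih =>
      refine ih.trans ?_
      have h1 := h (n + j + 1) (by omega)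
      rw [add_sub_cancel_right] at h1
      rw [h1, norm_mul, show n + ((j + 1 : ℕ) : ℤ) = n + j + 1 by push_cast; ring]
      exact mul_le_of_le_one_left (norm_nonneg _) hβ
  have hinj : Function.Injective fun j : ℕ => n + (j : ℤ) := fun i j hij => by
    simp only at hij; omega
  have hlim := (ha.comp hinj.tendsto_cofinite).norm
  rw [Nat.cofinite_eq_atTop, norm_zero] at hlim
  exact norm_le_zero_iff.1 (ge_of_tendsto' hlim hle)

/-- Multiplication by `(X - C β) * c` on the circle, one factor after the other. -/
theorem fourierCoeff_X_sub_C_mul_mul {p : ℝ≥0∞} [Fact (1 ≤ p)] (f : Lp ℂ p arc) (β : ℂ) (c : ℂ[X])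
    (n : ℤ) :
    fourierCoeff (fun t => ((X - C β) * c).eval (pt t) * f t) n =
      fourierCoeff (fun t => c.eval (pt t) * f t) (n - 1) -
        β * fourierCoeff (fun t => c.eval (pt t) * f t) n := by
  have hg := (memLp_polyMul c f).coeFn_toLp
  rw [← fourierCoeff_congr hg, ← fourierCoeff_congr hg, ← fourierCoeff_X_sub_C_mul]
  refine fourierCoeff_congr ?_ n
  filter_upwards [hg] with t ht
  rw [ht, eval_mul, mul_assoc]

theorem fourierCoeff_C_mul_div {p : ℝ≥0∞} (f : Lp ℂ p arc) {c : ℂ} (hc : c ≠ 0) {n : ℤ}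
    (h : fourierCoeff (fun t => (C c : ℂ[X]).eval (pt t) * f t) n = 0) : fourierCoeff f n = 0 := by
  simp only [eval_C] at h
  rw [fourierCoeff.const_mul] at h
  exact (mul_eq_zero.1 h).resolve_left hc

/-- Division by a polynomial without roots in the open disc preserves analyticity. -/
theorem fourierCoeff_neg_eq_zero_of_polyMul {p : ℝ≥0∞} [Fact (1 ≤ p)] (f : Lp ℂ p arc) (k : ℕ) :
    ∀ b : ℂ[X], b.natDegree = k → b ≠ 0 → (∀ z, b.IsRoot z → 1 ≤ ‖z‖) →
      (∀ n < 0, fourierCoeff (fun t => b.eval (pt t) * f t) n = 0) →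
      ∀ n < 0, fourierCoeff f n = 0 := by
  induction k with
  | zero =>
    intro b hk hb _ h n hn
    rw [eq_C_of_natDegree_eq_zero hk] at h hb
    exact fourierCoeff_C_mul_div f (by simpa using hb) (h n hn)
  | succ k ih =>
    intro b hk hb hroot h
    obtain ⟨β, hβ⟩ : ∃ β, b.IsRoot β := IsAlgClosed.exists_root b (by
      rw [degree_eq_natDegree hb, hk]; exact_mod_cast k.succ_ne_zero)
    obtain ⟨c, rfl⟩ := dvd_iff_isRoot.2 hβ
    have hc : c ≠ 0 := right_ne_zero_of_mul hb
    rw [natDegree_mul (X_sub_C_ne_zero β) hc, natDegree_X_sub_C] at hk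
    refine ih c (by omega) hc (fun z hz => hroot z (root_mul.2 (Or.inr hz))) ?_
    refine eq_zero_of_recurrence_neg (tendsto_fourierCoeff_cofinite _) (hroot β hβ) fun n hn => ?_
    have h1 := h n hn
    rw [fourierCoeff_X_sub_C_mul_mul] at h1
    exact sub_eq_zero.1 h1

/-- Division by a polynomial with roots in the closed disc lowers the upper end of the
spectrum by its degree. -/
theorem fourierCoeff_ge_eq_zero_of_polyMul {p : ℝ≥0∞} [Fact (1 ≤ p)] (f : Lp ℂ p arc) (k : ℕ) :
    ∀ (b : ℂ[X]) (N : ℤ), b.natDegree = k → b ≠ 0 → (∀ z, b.IsRoot z → ‖z‖ ≤ 1) →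
      (∀ n, N ≤ n → fourierCoeff (fun t => b.eval (pt t) * f t) n = 0) →
      ∀ n, N - k ≤ n → fourierCoeff f n = 0 := by
  induction k with
  | zero =>
    intro b N hk hb _ h n hn
    rw [eq_C_of_natDegree_eq_zero hk] at h hb
    exact fourierCoeff_C_mul_div f (by simpa using hb) (h n (by simpa using hn))
  | succ k ih =>
    intro b N hk hb hroot h n hn
    obtain ⟨β, hβ⟩ : ∃ β, b.IsRoot β := IsAlgClosed.exists_root b (by
      rw [degree_eq_natDegree hb, hk]; exact_mod_cast k.succ_ne_zero)
    obtain ⟨c, rfl⟩ := dvd_iff_isRoot.2 hβ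
    have hc : c ≠ 0 := right_ne_zero_of_mul hb
    rw [natDegree_mul (X_sub_C_ne_zero β) hc, natDegree_X_sub_C] at hk
    -- Removing one factor lowers the bound to N - 1; the k roots of c account for the rest.
    refine ih c (N - 1) (by omega) hc (fun z hz => hroot z (root_mul.2 (Or.inr hz))) ?_ n
      (by push_cast at hn; omega)
    refine eq_zero_of_recurrence_ge (tendsto_fourierCoeff_cofinite _) (hroot β hβ) fun n hn => ?_
    have h1 := h n hn
    rw [fourierCoeff_X_sub_C_mul_mul] at h1
    exact sub_eq_zero.1 h1

end ToeplitzLike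

namespace ToeplitzLike

/-! ### The Hardy space as a module over the polynomials -/

section HardyModule

variable {p : ℝ≥0∞} [Fact (1 ≤ p)]

/-- Fourier coefficients of an element of the Hardy space. -/
noncomputable def coef (v : Hardy p) (n : ℤ) : ℂ := fourierCoeff (v : Lp ℂ p arc) n

theorem coef_of_neg (v : Hardy p) {n : ℤ} (hn : n < 0) : coef v n = 0 := v.2 n hn

theorem coef_add (v w : Hardy p) (n : ℤ) : coef (v + w) n = coef v n + coef w n :=
  fourierCoeff_Lp_add _ _ n

theorem coef_smul (c : ℂ) (v : Hardy p) (n : ℤ) : coef (c • v) n = c * coef v n :=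
  fourierCoeff_Lp_smul c _ n

theorem coef_zero (n : ℤ) : coef (0 : Hardy p) n = 0 := fourierCoeff_Lp_zero n

theorem coef_sub (v w : Hardy p) (n : ℤ) : coef (v - w) n = coef v n - coef w n := by
  rw [sub_eq_add_neg, ← neg_one_smul ℂ w, coef_add, coef_smul]
  ring

theorem Hardy.ext_ae {v w : Hardy p} (h : (v : Lp ℂ p arc) =ᵐ[arc] (w : Lp ℂ p arc)) : v = w :=
  Subtype.ext (Lp.ext h)

theorem Hardy.ext_coef {v w : Hardy p} (h : ∀ n : ℤ, 0 ≤ n → coef v n = coef w n) : v = w := by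
  rw [← sub_eq_zero]
  have h0 : ∀ n : ℤ, coef (v - w) n = 0 := by
    intro n
    rcases lt_or_ge n 0 with hn | hn
    · exact coef_of_neg _ hn
    · rw [coef_sub, h n hn, sub_self]
  exact Subtype.ext (Lp.eq_zero_iff_ae_eq_zero.2
    (ae_eq_zero_of_fourierCoeff_eq_zero (integrable_Lp ((v - w : Hardy p) : Lp ℂ p arc)) h0))

theorem coeFn_Hardy_add (v w : Hardy p) : ((v + w : Hardy p) : Lp ℂ p arc) =ᵐ[arc]
    fun t => (v : Lp ℂ p arc) t + (w : Lp ℂ p arc) t := Lp.coeFn_add _ _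

theorem coeFn_Hardy_sub (v w : Hardy p) : ((v - w : Hardy p) : Lp ℂ p arc) =ᵐ[arc]
    fun t => (v : Lp ℂ p arc) t - (w : Lp ℂ p arc) t := Lp.coeFn_sub _ _

theorem coeFn_Hardy_smul (c : ℂ) (v : Hardy p) : ((c • v : Hardy p) : Lp ℂ p arc) =ᵐ[arc]
    fun t => c * (v : Lp ℂ p arc) t := Lp.coeFn_smul _ _

theorem coeFn_polyMul (a : ℂ[X]) (v : Hardy p) : ((polyMul a v : Hardy p) : Lp ℂ p arc) =ᵐ[arc]
    fun t => a.eval (pt t) * (v : Lp ℂ p arc) t := (memLp_polyMul a (v : Lp ℂ p arc)).coeFn_toLp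

theorem coef_polyMul (a : ℂ[X]) (v : Hardy p) (n : ℤ) :
    coef (polyMul a v) n = fourierCoeff (fun t => a.eval (pt t) * (v : Lp ℂ p arc) t) n :=
  fourierCoeff_congr (coeFn_polyMul a v) n

theorem coef_polyMul_eq_sum (a : ℂ[X]) (v : Hardy p) (n : ℤ) :
    coef (polyMul a v) n = a.sum fun k c => c * coef v (n - k) := by
  rw [coef_polyMul, fourierCoeff_polyMul]
  rfl

theorem polyMul_add (a : ℂ[X]) (v w : Hardy p) :
    polyMul a (v + w) = polyMul a v + polyMul a w := by
  refine Hardy.ext_ae ?_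
  filter_upwards [coeFn_polyMul a (v + w), coeFn_polyMul a v, coeFn_polyMul a w,
    coeFn_Hardy_add v w, coeFn_Hardy_add (polyMul a v) (polyMul a w)] with t h1 h2 h3 h4 h5
  rw [h1, h4, h5, h2, h3, mul_add]

theorem polyMul_smul (a : ℂ[X]) (c : ℂ) (v : Hardy p) :
    polyMul a (c • v) = c • polyMul a v := by
  refine Hardy.ext_ae ?_
  filter_upwards [coeFn_polyMul a (c • v), coeFn_polyMul a v,
    coeFn_Hardy_smul c v, coeFn_Hardy_smul c (polyMul a v)] with t h1 h2 h4 h5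
  rw [h1, h4, h5, h2, mul_left_comm]

theorem add_polyMul (a b : ℂ[X]) (v : Hardy p) :
    polyMul (a + b) v = polyMul a v + polyMul b v := by
  refine Hardy.ext_ae ?_
  filter_upwards [coeFn_polyMul (a + b) v, coeFn_polyMul a v, coeFn_polyMul b v,
    coeFn_Hardy_add (polyMul a v) (polyMul b v)] with t h1 h2 h3 h5
  rw [h1, h5, h2, h3, eval_add, add_mul]

theorem smul_polyMul (c : ℂ) (a : ℂ[X]) (v : Hardy p) :
    polyMul (c • a) v = c • polyMul a v := by
  refine Hardy.ext_ae ?_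
  filter_upwards [coeFn_polyMul (c • a) v, coeFn_polyMul a v,
    coeFn_Hardy_smul c (polyMul a v)] with t h1 h2 h5
  rw [h1, h5, h2, eval_smul, smul_eq_mul, mul_assoc]

theorem mul_polyMul (a b : ℂ[X]) (v : Hardy p) :
    polyMul (a * b) v = polyMul a (polyMul b v) := by
  refine Hardy.ext_ae ?_
  filter_upwards [coeFn_polyMul (a * b) v, coeFn_polyMul b v,
    coeFn_polyMul a (polyMul b v)] with t h1 h2 h3
  rw [h1, h3, h2, eval_mul, mul_assoc]

theorem one_polyMul (v : Hardy p) : polyMul 1 v = v := by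
  refine Hardy.ext_ae ?_
  filter_upwards [coeFn_polyMul 1 v] with t h1
  rw [h1, eval_one, one_mul]

theorem sub_polyMul (a b : ℂ[X]) (v : Hardy p) :
    polyMul (a - b) v = polyMul a v - polyMul b v := by
  rw [eq_sub_iff_add_eq, ← add_polyMul, sub_add_cancel]

theorem polyMul_left_comm (a b : ℂ[X]) (v : Hardy p) :
    polyMul a (polyMul b v) = polyMul b (polyMul a v) := by
  rw [← mul_polyMul, mul_comm a b, mul_polyMul]

theorem zero_polyMul (v : Hardy p) : polyMul 0 v = 0 := by
  have h := smul_polyMul 0 0 v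
  rwa [zero_smul, zero_smul] at h

theorem polyMul_zero (a : ℂ[X]) : polyMul a (0 : Hardy p) = 0 := by
  have h := polyMul_smul a 0 (0 : Hardy p)
  rwa [zero_smul, zero_smul] at h

theorem polyMul_injective {a : ℂ[X]} (ha : a ≠ 0) :
    Function.Injective (polyMul a : Hardy p → Hardy p) := by
  intro v w h
  refine Hardy.ext_ae ?_
  have h1 : ((polyMul a v : Hardy p) : Lp ℂ p arc) =ᵐ[arc] (polyMul a w : Hardy p) := by rw [h]
  filter_upwards [coeFn_polyMul a v, coeFn_polyMul a w, h1, ae_pt_not_root ha] with t h2 h3 h4 h5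
  rw [h2, h3] at h4
  exact mul_left_cancel₀ h5 h4

variable (p) in
/-- The constant function `1` in the Hardy space. -/
noncomputable def Hardy.one : Hardy p :=
  ⟨(memLp_const (1 : ℂ)).toLp, by
    intro n hn
    have h : (fun _ : Torus => (1 : ℂ)) = fourier 0 := by ext; simp
    rw [fourierCoeff_congr (memLp_const (1 : ℂ)).coeFn_toLp, h, fourierCoeff_fourier]
    simp [hn.ne]⟩

theorem coeFn_one : ((Hardy.one p : Hardy p) : Lp ℂ p arc) =ᵐ[arc] fun _ => 1 :=
  (memLp_const (1 : ℂ)).coeFn_toLp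

theorem coef_one (n : ℤ) : coef (Hardy.one p) n = if n = 0 then 1 else 0 := by
  have h : (fun _ : Torus => (1 : ℂ)) = fourier 0 := by ext; simp
  rw [coef, fourierCoeff_congr coeFn_one, h, fourierCoeff_fourier]
  simp [Pi.single_apply]

variable (p) in
/-- A polynomial as an element of the Hardy space. -/
noncomputable def ofPoly (a : ℂ[X]) : Hardy p := polyMul a (Hardy.one p)

theorem coeFn_ofPoly (a : ℂ[X]) : ((ofPoly p a : Hardy p) : Lp ℂ p arc) =ᵐ[arc]
    fun t => a.eval (pt t) := by
  filter_upwards [coeFn_polyMul a (Hardy.one p), coeFn_one (p := p)] with t h1 h2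
  rw [ofPoly, h1, h2, mul_one]

theorem polyMul_ofPoly (a b : ℂ[X]) : polyMul a (ofPoly p b) = ofPoly p (a * b) :=
  (mul_polyMul a b _).symm

theorem coef_ofPoly_natCast (a : ℂ[X]) (n : ℕ) : coef (ofPoly p a) n = a.coeff n := by
  rw [ofPoly, coef_polyMul_eq_sum, Polynomial.sum]
  simp only [coef_one]
  have : ∀ k : ℕ, ((n : ℤ) - k = 0) ↔ n = k := fun k => by omega
  simp [this]
  exact fun h => h.symm

theorem ofPoly_zero : ofPoly p 0 = 0 := zero_polyMul _

theorem ofPoly_injective : Function.Injective (ofPoly p) := by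
  intro a b h
  ext n
  rw [← coef_ofPoly_natCast (p := p), h, coef_ofPoly_natCast]

theorem coef_X_pow_polyMul (N : ℕ) (v : Hardy p) (n : ℤ) :
    coef (polyMul (X ^ N) v) n = coef v (n - N) := by
  rw [coef_polyMul_eq_sum, X_pow_eq_monomial, sum_monomial_index _ _ (by simp), one_mul]

/-- The polynomial with the Fourier coefficients of `w` of index less than `N`. -/
noncomputable def truncation (w : Hardy p) (N : ℕ) : ℂ[X] :=
  ∑ i ∈ Finset.range N, C (coef w i) * X ^ i

theorem coeff_truncation (w : Hardy p) (N k : ℕ) :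
    (truncation w N).coeff k = if k < N then coef w k else 0 := by
  simp only [truncation, finsetSum_coeff, coeff_C_mul, coeff_X_pow, mul_ite, mul_one, mul_zero,
    Finset.sum_ite_eq, Finset.mem_range]

theorem degree_truncation_lt (w : Hardy p) (N : ℕ) : (truncation w N).degree < N := by
  rw [degree_lt_iff_coeff_zero]
  intro k hk
  rw [coeff_truncation, if_neg (not_lt.2 hk)]

/-- The truncation has all Fourier coefficients of w. This is how polynomials are recognised inside
the Hardy space. -/
theorem exists_ofPoly_of_coef_eq_zero (w : Hardy p) (N : ℕ) (h : ∀ n : ℤ, N ≤ n → coef w n = 0) :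
    ∃ c : ℂ[X], c.degree < N ∧ w = ofPoly p c := by
  refine ⟨truncation w N, degree_truncation_lt w N, Hardy.ext_coef fun n hn => ?_⟩
  obtain ⟨k, rfl⟩ := Int.eq_ofNat_of_zero_le hn
  rw [coef_ofPoly_natCast, coeff_truncation]
  split_ifs with hk
  · rfl
  · exact h k (by exact_mod_cast not_lt.1 hk)

/-- The function `z ^ N w`, for an integer `N` and `w` in the Hardy space, is in `L^p`. -/
theorem memLp_fourier_mul (N : ℤ) (w : Hardy p) :
    MemLp (fun t => fourier N t * (w : Lp ℂ p arc) t) p arc := by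
  refine MemLp.of_le_mul (c := 1) (Lp.memLp (w : Lp ℂ p arc)) ?_ ?_
  · exact (fourier N).continuous.aestronglyMeasurable.mul
      (Lp.memLp (w : Lp ℂ p arc)).aestronglyMeasurable
  · refine Filter.Eventually.of_forall fun t => ?_
    rw [norm_mul, fourier_apply, Circle.norm_coe]

theorem fourierCoeff_fourier_mul (N : ℤ) (w : Hardy p) (n : ℤ) :
    fourierCoeff (fun t => fourier N t * (w : Lp ℂ p arc) t) n = coef w (n - N) := by
  rw [coef, fourierCoeff, fourierCoeff]
  refine integral_congr_ae (Filter.Eventually.of_forall fun t => ?_)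
  simp only [smul_eq_mul]
  rw [← mul_assoc, ← fourier_add, show -n + N = -(n - N) by ring]

theorem pt_pow (k : ℕ) (t : Torus) : pt t ^ k = fourier (k : ℤ) t := by
  simp [pt, fourier_apply, AddCircle.toCircle_nsmul]

theorem fourier_neg_mul_pt_pow (N : ℕ) (t : Torus) :
    (fourier (-N : ℤ) t : ℂ) * pt t ^ N = 1 := by
  rw [pt_pow, ← fourier_add]
  simp

/-- Iterated backward shift: division by `X ^ N` with polynomial remainder. -/
theorem exists_backward_shift (N : ℕ) (w : Hardy p) :
    ∃ (k : Hardy p) (c : ℂ[X]), c.degree < N ∧ w = polyMul (X ^ N) k + ofPoly p c := by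
  set c := truncation w N
  have hcoef : ∀ n : ℤ, n < N → coef (w - ofPoly p c) n = 0 := by
    intro n hn
    rcases lt_or_ge n 0 with h0 | h0
    · exact coef_of_neg _ h0
    · obtain ⟨k, rfl⟩ := Int.eq_ofNat_of_zero_le h0
      rw [coef_sub, coef_ofPoly_natCast, coeff_truncation, if_pos (by exact_mod_cast hn), sub_self]
  -- With the first N coefficients removed, division by z ^ N produces no negative frequency.
  have hmem : (memLp_fourier_mul (-N) (w - ofPoly p c)).toLp ∈ Hardy p := by
    intro n hn
    rw [fourierCoeff_congr (MemLp.coeFn_toLp _), fourierCoeff_fourier_mul]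
    exact hcoef _ (by omega)
  refine ⟨⟨_, hmem⟩, c, degree_truncation_lt w N, ?_⟩
  rw [← sub_eq_iff_eq_add]
  refine Hardy.ext_ae ?_
  filter_upwards [coeFn_polyMul (X ^ N) ⟨_, hmem⟩,
    (memLp_fourier_mul (-N) (w - ofPoly p c)).coeFn_toLp] with t h1 h2
  rw [h1, h2, eval_pow, eval_X, ← mul_assoc, mul_comm (pt t ^ N), fourier_neg_mul_pt_pow, one_mul]

end HardyModule

/-! ### The pairing -/

section Pairing

variable {p p' : ℝ≥0∞} [Fact (1 ≤ p)] [Fact (1 ≤ p')]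

theorem pairing_conj_symm (f : Hardy p) (g : Hardy p') :
    (starRingEnd ℂ) (pairing f g) = pairing g f := by
  rw [pairing, pairing, ← integral_conj]
  refine integral_congr_ae (Filter.Eventually.of_forall fun t => ?_)
  simp [mul_comm]

/-- Moving a polynomial factor to the other side of the pairing. -/
theorem pairing_polyMul (a : ℂ[X]) {N : ℕ} (ha : a.natDegree ≤ N) (f : Hardy p) (g : Hardy p') :
    pairing (polyMul a f) (polyMul (X ^ N) g) =
      pairing f (polyMul ((a.map (starRingEnd ℂ)).reflect N) g) := by
  refine integral_congr_ae ?_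
  filter_upwards [coeFn_polyMul a f, coeFn_polyMul (X ^ N) g,
    coeFn_polyMul ((a.map (starRingEnd ℂ)).reflect N) g] with t h1 h2 h3
  rw [h1, h2, h3, eval_map_conj_reflect a N ha]
  simp only [eval_pow, eval_X, map_mul, map_pow, Complex.conj_conj]
  ring

theorem pairing_X_pow_X_pow (N : ℕ) (f : Hardy p) (g : Hardy p') :
    pairing (polyMul (X ^ N) f) (polyMul (X ^ N) g) = pairing f g := by
  rw [pairing_polyMul _ (natDegree_X_pow_le N)]
  simp [one_polyMul]

theorem pairing_X_pow (g : Hardy p') (j : ℕ) :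
    pairing (ofPoly p (X ^ j)) g = (starRingEnd ℂ) (coef g j) := by
  rw [← pairing_conj_symm, coef, fourierCoeff]
  congr 1
  refine integral_congr_ae ?_
  filter_upwards [coeFn_ofPoly (p := p) (X ^ j)] with t h1
  rw [h1, eval_pow, eval_X, pt_pow, smul_eq_mul, mul_comm, ← fourier_neg]

theorem pairing_smul_left (c : ℂ) (f : Hardy p) (g : Hardy p') :
    pairing (c • f) g = c * pairing f g := by
  rw [pairing, pairing, ← integral_const_mul]
  refine integral_congr_ae ?_
  filter_upwards [coeFn_Hardy_smul c f] with t ht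
  rw [ht, mul_assoc]

variable [ENNReal.HolderConjugate p p']

theorem pairing_add_left (f f' : Hardy p) (g : Hardy p') :
    pairing (f + f') g = pairing f g + pairing f' g := by
  rw [pairing, pairing, pairing, ← integral_add (integrable_pairing f g)
    (integrable_pairing f' g)]
  refine integral_congr_ae ?_
  filter_upwards [coeFn_Hardy_add f f'] with t ht
  rw [ht, add_mul]

theorem pairing_add_right (f : Hardy p) (g g' : Hardy p') :
    pairing f (g + g') = pairing f g + pairing f g' := by
  rw [pairing, pairing, pairing, ← integral_add (integrable_pairing f g)
    (integrable_pairing f g')]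
  refine integral_congr_ae ?_
  filter_upwards [coeFn_Hardy_add g g'] with t ht
  rw [ht, map_add, mul_add]

theorem pairing_ofPoly_left (a : ℂ[X]) (g : Hardy p') :
    pairing (ofPoly p a) g = a.sum fun j c => c * (starRingEnd ℂ) (coef g j) := by
  induction a using Polynomial.induction_on' with
  | add a b ha hb =>
    rw [ofPoly, add_polyMul, pairing_add_left, ← ofPoly, ← ofPoly, ha, hb,
      Polynomial.sum_add_index _ _ _ (by simp) (by intros; ring)]
  | monomial n c =>
    rw [sum_monomial_index _ _ (by simp), ← mul_one c, ← smul_eq_mul, ← smul_monomial, ofPoly,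
      smul_polyMul, pairing_smul_left, ← ofPoly, ← X_pow_eq_monomial, pairing_X_pow,
      smul_eq_mul, mul_one]

/-- Functions with disjoint spectra are orthogonal; this makes the remainder r in s f = q h + r
invisible to the adjoint. -/
theorem pairing_ofPoly_X_pow {c : ℂ[X]} {N : ℕ} (hc : c.degree < N) (g : Hardy p') :
    pairing (ofPoly p c) (polyMul (X ^ N) g) = 0 := by
  rw [pairing_ofPoly_left]
  refine Finset.sum_eq_zero fun j hj => ?_
  have h1 : j < N := by
    exact_mod_cast (le_degree_of_mem_supp j hj).trans_lt hc
  simp only [coef_X_pow_polyMul]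
  rw [coef_of_neg _ (by omega), map_zero, mul_zero]

theorem pairing_X_pow_ofPoly {c : ℂ[X]} {N : ℕ} (hc : c.degree < N) (f : Hardy p) :
    pairing (polyMul (X ^ N) f) (ofPoly p' c) = 0 := by
  have : ENNReal.HolderConjugate p' p := ENNReal.HolderConjugate.symm
  rw [← pairing_conj_symm, pairing_ofPoly_X_pow hc, map_zero]

end Pairing

end ToeplitzLike

namespace ToeplitzLike

/-! ### The graph of `T_ω` -/

section Graph

variable {ω : RatFunc ℂ} {s q : ℂ[X]}

theorem onCircle_div_ae (hq : q ≠ 0)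
    (hωsq : ω = algebraMap ℂ[X] (RatFunc ℂ) s / algebraMap ℂ[X] (RatFunc ℂ) q) :
    ∀ᵐ t ∂arc, onCircle ω t = s.eval (pt t) / q.eval (pt t) := by
  filter_upwards [ae_pt_not_root hq] with t ht
  rw [onCircle, hωsq, eval_div_algebraMap _ _ _ ht]

/-- Lowest terms are unique up to a unit, so roots and degrees may be read off from any coprime
representation. -/
theorem associated_denom (hq : q ≠ 0) (hsq : IsCoprime s q)
    (hωsq : ω = algebraMap ℂ[X] (RatFunc ℂ) s / algebraMap ℂ[X] (RatFunc ℂ) q) :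
    Associated ω.denom q := by
  have h1 : ω.num * q = s * ω.denom := (RatFunc.num_mul_eq_mul_denom_iff hq).2 hωsq
  refine associated_of_dvd_dvd (hωsq ▸ RatFunc.denom_div_dvd s q) ?_
  exact hsq.symm.dvd_of_dvd_mul_left ⟨ω.num, by rw [← h1, mul_comm]⟩

theorem associated_num (hq : q ≠ 0) (hsq : IsCoprime s q)
    (hωsq : ω = algebraMap ℂ[X] (RatFunc ℂ) s / algebraMap ℂ[X] (RatFunc ℂ) q) :
    Associated ω.num s := by
  have h1 : ω.num * q = s * ω.denom := (RatFunc.num_mul_eq_mul_denom_iff hq).2 hωsq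
  refine associated_of_dvd_dvd ?_ ?_
  · exact ω.isCoprime_num_denom.dvd_of_dvd_mul_right ⟨q, h1.symm⟩
  · exact hsq.dvd_of_dvd_mul_right ⟨ω.denom, h1⟩

theorem div_mem_RatT0 {r : ℂ[X]} (hq : q ≠ 0) (hroot : ∀ z, q.IsRoot z → ‖z‖ = 1)
    (hr : r.degree < q.degree) :
    algebraMap ℂ[X] (RatFunc ℂ) r / algebraMap ℂ[X] (RatFunc ℂ) q ∈ RatT0 := by
  set ρ := algebraMap ℂ[X] (RatFunc ℂ) r / algebraMap ℂ[X] (RatFunc ℂ) q with hρ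
  have hd : ρ.denom ∣ q := RatFunc.denom_div_dvd r q
  refine ⟨fun z hz => hroot z (hz.dvd hd), ?_⟩
  have h1 : ρ.num * q = r * ρ.denom := (RatFunc.num_mul_eq_mul_denom_iff hq).2 hρ
  by_cases hr0 : r = 0
  · have : ρ.num = 0 := by
      rw [hr0, zero_mul] at h1
      exact (mul_eq_zero.1 h1).resolve_right hq
    rw [this, degree_zero, degree_eq_natDegree ρ.denom_ne_zero]
    exact WithBot.bot_lt_coe _
  · have hn0 : ρ.num ≠ 0 := by
      intro h0
      rw [h0, zero_mul] at h1
      exact mul_ne_zero hr0 ρ.denom_ne_zero h1.symm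
    have h2 := congrArg natDegree h1
    rw [natDegree_mul hn0 hq, natDegree_mul hr0 ρ.denom_ne_zero] at h2
    rw [degree_eq_natDegree hr0, degree_eq_natDegree hq, Nat.cast_lt] at hr
    rw [degree_eq_natDegree hn0, degree_eq_natDegree ρ.denom_ne_zero, Nat.cast_lt]
    omega

variable {p : ℝ≥0∞} [Fact (1 ≤ p)]

/-- Division by q gives ω f = h + r / q, and the analytic h is its own Riesz projection. -/
theorem mem_toeplitzGraph_of_eq (hq : q ≠ 0) (hroot : ∀ z, q.IsRoot z → ‖z‖ = 1)
    (hωsq : ω = algebraMap ℂ[X] (RatFunc ℂ) s / algebraMap ℂ[X] (RatFunc ℂ) q)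
    {f h : Hardy p} {r : ℂ[X]} (hr : r.degree < q.degree)
    (heq : polyMul s f = polyMul q h + ofPoly p r) : (f, h) ∈ toeplitzGraph p ω := by
  refine ⟨h, _, div_mem_RatT0 hq hroot hr, ?_, fun _ _ => rfl⟩
  have h0 : ((polyMul s f : Hardy p) : Lp ℂ p arc) =ᵐ[arc]
    (polyMul q h + ofPoly p r : Hardy p) := by rw [heq]
  filter_upwards [onCircle_div_ae hq hωsq, onCircle_div_ae (s := r) hq rfl, ae_pt_not_root hq, h0,
    coeFn_polyMul s f, coeFn_polyMul q h, coeFn_ofPoly (p := p) r,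
    coeFn_Hardy_add (polyMul q h) (ofPoly p r)] with t h1 h2 h3 h4 h5 h6 h7 h8
  rw [h5, h8, h6, h7] at h4
  rw [h1, h2, div_mul_eq_mul_div, h4]
  field_simp

/-- Multiplying ω f = F + ρ by q gives s f = q F + q ρ. Then q ρ is integrable, which forces it to
be a polynomial; so q F is analytic, hence F is, and F = h. -/
theorem exists_of_mem_toeplitzGraph (hq : q ≠ 0) (hroot : ∀ z, q.IsRoot z → ‖z‖ = 1)
    (hωsq : ω = algebraMap ℂ[X] (RatFunc ℂ) s / algebraMap ℂ[X] (RatFunc ℂ) q)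
    {f h : Hardy p} (hmem : (f, h) ∈ toeplitzGraph p ω) :
    ∃ r : ℂ[X], r.degree < q.degree ∧ polyMul s f = polyMul q h + ofPoly p r := by
  obtain ⟨F, ρ, hρ, hF, hh⟩ := hmem
  simp only at hF hh
  have hbm : ρ.denom.Monic := ρ.monic_denom
  set d := (q * ρ.num) /ₘ ρ.denom
  set e := (q * ρ.num) %ₘ ρ.denom
  have hde : e + ρ.denom * d = q * ρ.num := modByMonic_add_div _ _
  have hρval : ∀ᵐ t ∂arc, q.eval (pt t) * onCircle ρ t =
      d.eval (pt t) + e.eval (pt t) / ρ.denom.eval (pt t) := by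
    filter_upwards [eval_denom_ne_zero_ae ρ] with t ht
    have h1 := congrArg (eval (pt t)) hde
    simp only [eval_add, eval_mul] at h1
    rw [onCircle, RatFunc.eval, eval₂_id, eval₂_id]
    field_simp
    rw [← h1]
    ring
  have hF2 : ∀ᵐ t ∂arc, s.eval (pt t) * (f : Lp ℂ p arc) t =
      q.eval (pt t) * F t + q.eval (pt t) * onCircle ρ t := by
    filter_upwards [hF, onCircle_div_ae hq hωsq, ae_pt_not_root hq] with t h1 h2 h3
    rw [← mul_add, ← h1, h2]
    field_simp
  -- The fractional part of q ρ equals s f - q F - d, which is integrable, so its poles on the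
  -- circle must cancel.
  have he : e = 0 := by
    refine num_eq_zero_of_integrable _ e ρ.denom rfl ρ.denom_ne_zero
      (degree_modByMonic_lt _ hbm) hρ.1 ?_
    have h1 : Integrable (fun t => s.eval (pt t) * (f : Lp ℂ p arc) t) arc :=
      (memLp_polyMul s (f : Lp ℂ p arc)).integrable Fact.out
    have h2 : Integrable (fun t => q.eval (pt t) * F t) arc :=
      (memLp_polyMul q F).integrable Fact.out
    have h3 : Integrable (fun t => d.eval (pt t)) arc := by
      obtain ⟨D, hD⟩ := exists_bound d
      exact Integrable.of_bound (d.continuous.comp continuous_pt).aestronglyMeasurable D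
        (Filter.Eventually.of_forall hD)
    refine ((h1.sub h2).sub h3).congr ?_
    filter_upwards [hρval, hF2] with t h4 h5
    simp only [Pi.sub_apply]
    rw [h5, h4]
    ring
  rw [he, zero_add] at hde
  have hdeg : d.degree < q.degree := by
    by_cases hd0 : d = 0
    · rw [hd0, degree_zero, degree_eq_natDegree hq]
      exact WithBot.bot_lt_coe _
    have hn0 : ρ.num ≠ 0 := by
      intro h0
      rw [h0, mul_zero] at hde
      exact mul_ne_zero ρ.denom_ne_zero hd0 hde
    have h2 := congrArg natDegree hde
    rw [natDegree_mul hq hn0, natDegree_mul ρ.denom_ne_zero hd0] at h2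
    have h3 := hρ.2
    rw [degree_eq_natDegree hn0, degree_eq_natDegree ρ.denom_ne_zero, Nat.cast_lt] at h3
    rw [degree_eq_natDegree hd0, degree_eq_natDegree hq, Nat.cast_lt]
    omega
  have hqF : (fun t => q.eval (pt t) * F t) =ᵐ[arc]
      ((polyMul s f - ofPoly p d : Hardy p) : Lp ℂ p arc) := by
    filter_upwards [hρval, hF2, coeFn_Hardy_sub (polyMul s f) (ofPoly p d), coeFn_polyMul s f,
      coeFn_ofPoly (p := p) d] with t h1 h2 h3 h4 h5
    rw [h3, h4, h5, h2, h1, he, eval_zero, zero_div]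
    ring
  -- All roots of q lie on the circle, so dividing the analytic function s f - d by q keeps it
  -- analytic.
  have hFneg : F ∈ Hardy p := by
    refine fourierCoeff_neg_eq_zero_of_polyMul F _ q rfl hq (fun z hz => (hroot z hz).ge) ?_
    intro n hn
    rw [fourierCoeff_congr hqF]
    exact coef_of_neg _ hn
  have hhF : h = ⟨F, hFneg⟩ := Hardy.ext_coef fun n hn => hh n hn
  refine ⟨d, hdeg, ?_⟩
  rw [← sub_eq_iff_eq_add]
  refine Hardy.ext_ae ?_
  filter_upwards [hqF, coeFn_polyMul q h] with t h1 h2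
  rw [← h1, h2, hhF]

end Graph

end ToeplitzLike

namespace ToeplitzLike

/-! ### The polynomial `r^♯` -/

section Sharp

theorem sharp_eq_reflect (a : ℂ[X]) : sharp a = (a.map (starRingEnd ℂ)).reflect a.natDegree := by
  rw [sharp, reverse, natDegree_map]

theorem sharp_mul (a b : ℂ[X]) : sharp (a * b) = sharp a * sharp b := by
  rw [sharp, Polynomial.map_mul, reverse_mul_of_domain, sharp, sharp]

theorem sharp_ne_zero {a : ℂ[X]} (ha : a ≠ 0) : sharp a ≠ 0 := by
  rw [sharp, Ne, reverse_eq_zero]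
  exact (Polynomial.map_ne_zero_iff (starRingEnd ℂ).injective).2 ha

theorem coeff_zero_sharp (a : ℂ[X]) : (sharp a).coeff 0 = (starRingEnd ℂ) a.leadingCoeff := by
  rw [sharp, coeff_zero_reverse, leadingCoeff_map]

theorem not_isRoot_zero_sharp {a : ℂ[X]} (ha : a ≠ 0) : ¬ (sharp a).IsRoot 0 := by
  rw [IsRoot, ← coeff_zero_eq_eval_zero, coeff_zero_sharp]
  simpa using ha

theorem reflect_conj_add (a : ℂ[X]) (k : ℕ) :
    (a.map (starRingEnd ℂ)).reflect (k + a.natDegree) = X ^ k * sharp a := by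
  have h := reflect_mul (1 : ℂ[X]) (a.map (starRingEnd ℂ)) (F := k) (G := a.natDegree) (by simp)
    natDegree_map_le
  rwa [one_mul, reflect_one, ← sharp_eq_reflect] at h

theorem natDegree_sharp_le (a : ℂ[X]) : (sharp a).natDegree ≤ a.natDegree :=
  (reverse_natDegree_le _).trans natDegree_map_le

/-- Each root of a at 0 would lower the degree of a^♯ by one; without such roots the top coefficient
of a^♯ is conj (a 0). -/
theorem natDegree_sharp {a : ℂ[X]} (ha : a.coeff 0 ≠ 0) : (sharp a).natDegree = a.natDegree := by
  refine le_antisymm (natDegree_sharp_le a) (le_natDegree_of_ne_zero ?_)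
  rw [sharp_eq_reflect, coeff_reflect, revAt_le le_rfl, Nat.sub_self, coeff_map]
  simpa using ha

/-- Follows from a^♯(z) = z ^ k conj (a (1 / conj z)): nonzero roots are reflected in the circle,
exchanging inside and outside. -/
theorem isRoot_of_isRoot_sharp {a : ℂ[X]} {z : ℂ} (hz : z ≠ 0) (h : (sharp a).IsRoot z) :
    a.IsRoot ((starRingEnd ℂ) z)⁻¹ := by
  let i : Invertible z⁻¹ := ⟨z, mul_inv_cancel₀ hz, inv_mul_cancel₀ hz⟩
  have h1 := eval₂_reflect_mul_pow (RingHom.id ℂ) z⁻¹ a.natDegree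
    (a.map (starRingEnd ℂ)) natDegree_map_le
  have h' : ⅟z⁻¹ = z := rfl
  rw [h', ← sharp_eq_reflect, eval₂_id, eval₂_id, h.eq_zero, zero_mul] at h1
  have h2 : z⁻¹ = (starRingEnd ℂ) ((starRingEnd ℂ) z)⁻¹ := by simp
  rw [h2, eval_map_apply] at h1
  exact (map_eq_zero _).1 h1.symm

theorem norm_of_isRoot_sharp {a : ℂ[X]} (ha : a ≠ 0) {z : ℂ} (h : (sharp a).IsRoot z) :
    ∃ w, a.IsRoot w ∧ ‖w‖ = ‖z‖⁻¹ ∧ 0 < ‖z‖ := by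
  have hz : z ≠ 0 := by
    rintro rfl
    exact not_isRoot_zero_sharp ha h
  exact ⟨_, isRoot_of_isRoot_sharp hz h, by rw [norm_inv, RCLike.norm_conj], norm_pos_iff.2 hz⟩

theorem isCoprime_iff_no_common_root {a b : ℂ[X]} :
    IsCoprime a b ↔ ∀ z, a.IsRoot z → ¬ b.IsRoot z := by
  rw [isCoprime_iff_aeval_ne_zero_of_isAlgClosed ℂ ℂ]
  simp only [coe_aeval_eq_eval, IsRoot, imp_iff_not_or, Ne]

/-- A common root is nonzero, because b^♯ does not vanish at 0, and reflects to a common root of a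
and b. -/
theorem isCoprime_sharp {a b : ℂ[X]} (ha : b ≠ 0) (h : IsCoprime a b) :
    IsCoprime (sharp a) (sharp b) := by
  rw [isCoprime_iff_no_common_root] at h ⊢
  intro z h1 h2
  have hz : z ≠ 0 := by
    rintro rfl
    exact not_isRoot_zero_sharp ha h2
  exact h _ (isRoot_of_isRoot_sharp hz h1) (isRoot_of_isRoot_sharp hz h2)

theorem isCoprime_X_pow {b : ℂ[X]} (hb : ¬ b.IsRoot 0) (k : ℕ) : IsCoprime (X ^ k) b := by
  refine IsCoprime.pow_left ?_
  rw [isCoprime_iff_no_common_root]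
  intro z hz hz'
  rw [IsRoot, eval_X] at hz
  exact hb (hz ▸ hz')

end Sharp

/-! ### The adjoint relation -/

section Adjoint

variable {p p' : ℝ≥0∞} [Fact (1 ≤ p)] [Fact (1 ≤ p')] [ENNReal.HolderConjugate p p']
  {ω : RatFunc ℂ} {s q : ℂ[X]}

theorem mem_adjointGraph_iff {u k : Hardy p'} : (u, k) ∈ adjointGraph (toeplitz p ω) ↔
    ∀ f h : Hardy p, (f, h) ∈ toeplitzGraph p ω → pairing h u = pairing f k := by
  constructor
  · intro hm f h hfh
    rw [← graph_toeplitz, LinearPMap.mem_graph_iff] at hfh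
    obtain ⟨y, hy1, hy2⟩ := hfh
    simp only at hy1 hy2
    rw [← hy1, ← hy2]
    exact hm y
  · intro hm f
    refine hm f (toeplitz p ω f) ?_
    rw [← graph_toeplitz]
    exact LinearPMap.mem_graph _ f

/-- The easy direction: q^♯ crosses the pairing back to q, q h is exchanged for s f at the cost of
r, and s crosses as s^♯. Both remainders are orthogonal to what they meet. -/
theorem mem_adjointGraph_of_eq (hq : q ≠ 0) (hroot : ∀ z, q.IsRoot z → ‖z‖ = 1)
    (hωsq : ω = algebraMap ℂ[X] (RatFunc ℂ) s / algebraMap ℂ[X] (RatFunc ℂ) q)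
    {v k : Hardy p'} {c : ℂ[X]} (hc : c.degree < s.natDegree)
    (heq : polyMul (X ^ q.natDegree) (polyMul (sharp s) v) =
      polyMul (X ^ s.natDegree) k + ofPoly p' c) :
    (polyMul (sharp q) v, k) ∈ adjointGraph (toeplitz p ω) := by
  rw [mem_adjointGraph_iff]
  intro f h hfh
  obtain ⟨r, hr, hrq⟩ := exists_of_mem_toeplitzGraph hq hroot hωsq hfh
  rw [degree_eq_natDegree hq] at hr
  calc pairing h (polyMul (sharp q) v)
      = pairing (polyMul q h) (polyMul (X ^ q.natDegree) v) := by
        rw [pairing_polyMul q le_rfl, sharp_eq_reflect]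
    _ = pairing (polyMul s f) (polyMul (X ^ q.natDegree) v) := by
        rw [hrq, pairing_add_left, pairing_ofPoly_X_pow hr, add_zero]
    -- The unimodular factor z ^ n on both sides is what s needs in order to cross as s^♯.
    _ = pairing (polyMul s (polyMul (X ^ s.natDegree) f))
          (polyMul (X ^ s.natDegree) (polyMul (X ^ q.natDegree) v)) := by
        rw [polyMul_left_comm, pairing_X_pow_X_pow]
    _ = pairing (polyMul (X ^ s.natDegree) f) (polyMul (X ^ s.natDegree) k + ofPoly p' c) := by
        rw [pairing_polyMul s le_rfl, ← sharp_eq_reflect, polyMul_left_comm, heq]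
    _ = pairing f k := by
        rw [pairing_add_right, pairing_X_pow_X_pow, pairing_X_pow_ofPoly hc, add_zero]

theorem pairing_ofPoly_eq_of_mem_adjointGraph (hq : q ≠ 0) (hroot : ∀ z, q.IsRoot z → ‖z‖ = 1)
    (hωsq : ω = algebraMap ℂ[X] (RatFunc ℂ) s / algebraMap ℂ[X] (RatFunc ℂ) q)
    {u k : Hardy p'} (hmem : (u, k) ∈ adjointGraph (toeplitz p ω))
    {f h r : ℂ[X]} (hr : r.degree < q.degree) (h1 : s * f = q * h + r) :
    pairing (ofPoly p h) u = pairing (ofPoly p f) k := by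
  refine mem_adjointGraph_iff.1 hmem _ _ (mem_toeplitzGraph_of_eq hq hroot hωsq hr ?_)
  rw [polyMul_ofPoly, polyMul_ofPoly, h1, ofPoly, ofPoly, ofPoly, add_polyMul]

/-- The adjoint relation is single-valued, as all polynomials lie in the domain of `T_ω`. -/
theorem adjointGraph_single_valued (hq : q ≠ 0) (hroot : ∀ z, q.IsRoot z → ‖z‖ = 1)
    (hωsq : ω = algebraMap ℂ[X] (RatFunc ℂ) s / algebraMap ℂ[X] (RatFunc ℂ) q)
    {k : Hardy p'} (hmem : ((0 : Hardy p'), k) ∈ adjointGraph (toeplitz p ω)) : k = 0 := by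
  refine Hardy.ext_coef fun n hn => ?_
  obtain ⟨j, rfl⟩ := Int.eq_ofNat_of_zero_le hn
  -- Dividing s z ^ j by q exhibits z ^ j as an element of the domain; its pairing with k is the
  -- conjugate of the j-th coefficient.
  have h := pairing_ofPoly_eq_of_mem_adjointGraph hq hroot hωsq hmem
    (degree_mod_lt (s * X ^ j) hq) (EuclideanDomain.div_add_mod (s * X ^ j) q).symm
  have h0 : ∀ f : Hardy p, pairing f (0 : Hardy p') = 0 := by
    intro f
    have := pairing_add_right f (0 : Hardy p') 0
    rwa [add_zero, left_eq_add] at this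
  rw [h0, pairing_X_pow] at h
  rw [coef_zero]
  exact (map_eq_zero _).1 h.symm

/-- The test functions q z ^ j, with image s z ^ j and no remainder, equate the Fourier coefficients
of both products from index deg q + deg s on. -/
theorem exists_polyMul_sharp_eq_add_ofPoly (hq : q ≠ 0) (hroot : ∀ z, q.IsRoot z → ‖z‖ = 1)
    (hωsq : ω = algebraMap ℂ[X] (RatFunc ℂ) s / algebraMap ℂ[X] (RatFunc ℂ) q)
    {u k : Hardy p'} (hmem : (u, k) ∈ adjointGraph (toeplitz p ω)) :
    ∃ E : ℂ[X], polyMul (X ^ q.natDegree * sharp s) u =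
      polyMul (X ^ s.natDegree * sharp q) k + ofPoly p' E := by
  suffices h : ∀ i : ℤ, (q.natDegree + s.natDegree : ℕ) ≤ i →
      coef (polyMul (X ^ q.natDegree * sharp s) u - polyMul (X ^ s.natDegree * sharp q) k) i = 0 by
    obtain ⟨E, -, hE⟩ := exists_ofPoly_of_coef_eq_zero _ _ h
    exact ⟨E, by rw [← hE]; abel⟩
  intro i hi
  obtain ⟨j, rfl⟩ : ∃ j : ℕ, i = j + (q.natDegree + s.natDegree : ℕ) :=
    ⟨(i - (q.natDegree + s.natDegree : ℕ)).toNat, by omega⟩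
  have h0 := pairing_ofPoly_eq_of_mem_adjointGraph hq hroot hωsq hmem
    (f := q * X ^ j) (h := s * X ^ j) (r := 0)
    (by rw [degree_zero, degree_eq_natDegree hq]; exact WithBot.bot_lt_coe _) (by ring)
  -- Reflecting s and q at the common exponent N, instead of at their own degrees, produces the
  -- factors z ^ deg q and z ^ deg s.
  set N := q.natDegree + s.natDegree
  rw [← pairing_X_pow_X_pow N, ← pairing_X_pow_X_pow N (ofPoly p (q * X ^ j)),
    ← polyMul_ofPoly, ← polyMul_ofPoly, polyMul_left_comm (X ^ N) s, polyMul_left_comm (X ^ N) q,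
    pairing_polyMul s (Nat.le_add_left _ _), pairing_polyMul q (Nat.le_add_right _ _),
    reflect_conj_add, polyMul_ofPoly, ← pow_add, pairing_X_pow, pairing_X_pow] at h0
  have h1 := (starRingEnd ℂ).injective h0
  rw [add_comm q.natDegree s.natDegree, reflect_conj_add] at h1
  rw [coef_sub, sub_eq_zero, show (j : ℤ) + (N : ℕ) = ((N + j : ℕ) : ℤ) by push_cast; ring]
  exact h1

theorem ofPoly_eq_zero_of_pairing_self {τ : ℂ[X]}
    (h : pairing (ofPoly p τ) (ofPoly p' τ) = 0) : τ = 0 := by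
  rw [pairing_ofPoly_left] at h
  simp only [coef_ofPoly_natCast] at h
  ext j
  by_contra hj
  rw [coeff_zero] at hj
  have h2 : ∑ j ∈ τ.support, Complex.normSq (τ.coeff j) = 0 := by
    rw [Polynomial.sum] at h
    simp only [Complex.mul_conj] at h
    exact_mod_cast h
  rw [Finset.sum_eq_zero_iff_of_nonneg fun _ _ => Complex.normSq_nonneg _] at h2
  exact hj (Complex.normSq_eq_zero.1 (h2 j (mem_support_iff.2 hj)))

/-- The domain of the adjoint contains no nonzero polynomial of degree less than `deg q`. -/
theorem eq_zero_of_ofPoly_mem_adjointGraph (hq : q ≠ 0) (hroot : ∀ z, q.IsRoot z → ‖z‖ = 1)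
    (hsq : IsCoprime s q)
    (hωsq : ω = algebraMap ℂ[X] (RatFunc ℂ) s / algebraMap ℂ[X] (RatFunc ℂ) q)
    {τ : ℂ[X]} {k : Hardy p'} (hτ : τ.degree < q.degree)
    (hmem : (ofPoly p' τ, k) ∈ adjointGraph (toeplitz p ω)) : τ = 0 := by
  have hq0 : ¬ q.IsRoot 0 := fun h => by simpa using hroot 0 h
  -- the image `k` is a polynomial
  obtain ⟨M, hM⟩ : ∃ M : ℕ, ∀ n : ℤ, M ≤ n → coef k n = 0 := by
    obtain ⟨E, hE⟩ := exists_polyMul_sharp_eq_add_ofPoly hq hroot hωsq hmem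
    set P := X ^ q.natDegree * sharp s * τ - E
    have hP : polyMul (X ^ s.natDegree * sharp q) k = ofPoly p' P := by
      rw [polyMul_ofPoly, ← sub_eq_iff_eq_add] at hE
      rw [← hE, ofPoly, ofPoly, ofPoly, ← sub_polyMul]
    -- All roots of z ^ n q^♯ lie in the closed disc, so dividing P by it cannot raise the top
    -- frequency.
    refine ⟨P.natDegree + 1, fun n hn => fourierCoeff_ge_eq_zero_of_polyMul _ _
      (X ^ s.natDegree * sharp q) (P.natDegree + 1) rfl
      (mul_ne_zero (pow_ne_zero _ X_ne_zero) (sharp_ne_zero hq)) ?_ ?_ n (by push_cast at hn; omega)⟩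
    · intro z hz
      rcases root_mul.1 hz with hz | hz
      · rw [IsRoot, eval_pow, eval_X] at hz
        rw [eq_zero_of_pow_eq_zero hz]
        simp
      · obtain ⟨w, hw, hwz, -⟩ := norm_of_isRoot_sharp hq hz
        rw [hroot w hw] at hwz
        exact (inv_eq_one.1 hwz.symm).le
    · intro i hi
      rw [← coef_polyMul, hP]
      obtain ⟨j, rfl⟩ := Int.eq_ofNat_of_zero_le (by omega : 0 ≤ i)
      rw [coef_ofPoly_natCast]
      exact coeff_eq_zero_of_natDegree_lt (by omega)
  set m := q.natDegree with hm
  set N := max M m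
  obtain ⟨c, hc, rfl⟩ := exists_ofPoly_of_coef_eq_zero k N fun n hn => hM n (by omega)
  -- a test polynomial divisible by `X ^ N` whose image is `τ` modulo `X ^ m`
  obtain ⟨a, b, hab⟩ : IsCoprime (s * X ^ N) q := hsq.mul_left (isCoprime_X_pow hq0 N)
  set r := -((q * τ) % X ^ m) with hr
  have hrdeg : r.degree < q.degree := by
    rw [hr, degree_neg, degree_eq_natDegree hq, ← degree_X_pow (R := ℂ)]
    exact degree_mod_lt _ (pow_ne_zero _ X_ne_zero)
  have htest := pairing_ofPoly_eq_of_mem_adjointGraph hq hroot hωsq hmem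
    (f := X ^ N * (a * r)) (h := -(b * r)) hrdeg (by linear_combination r * hab)
  -- Since N ≥ m, Bézout gives q (-(b r) - τ) ≡ -r - q τ modulo z ^ m. The choice of r makes this
  -- zero, and q is coprime to z ^ m.
  obtain ⟨y, hy⟩ : X ^ m ∣ -(b * r) - τ := by
    refine (isCoprime_X_pow hq0 m).dvd_of_dvd_mul_left
      ⟨s * X ^ (N - m) * a * r - (q * τ) / X ^ m, ?_⟩
    have h1 : (X ^ N : ℂ[X]) = X ^ m * X ^ (N - m) := by
      rw [← pow_add, Nat.add_sub_cancel' (le_max_right _ _)]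
    have h2 := EuclideanDomain.div_add_mod (q * τ) (X ^ m)
    rw [h1] at hab
    linear_combination (-r) * hab + h2 - hr
  -- The side of k vanishes because deg c < N, and z ^ m y is orthogonal to τ because deg τ < m;
  -- only ⟨τ, τ⟩ survives.
  rw [← polyMul_ofPoly, pairing_X_pow_ofPoly hc, sub_eq_iff_eq_add.1 hy, ofPoly, add_polyMul,
    pairing_add_left, ← ofPoly, ← ofPoly, ← polyMul_ofPoly,
    pairing_X_pow_ofPoly (by rwa [degree_eq_natDegree hq] at hτ), zero_add] at htest
  exact ofPoly_eq_zero_of_pairing_self htest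

/-- The adjoint relation of `T_ω`: `q^♯ v` is related to the analytic part of
`z ^ (deg q - deg s) s^♯ v`. -/
theorem mem_adjointGraph_toeplitz_iff (hq : q ≠ 0) (hroot : ∀ z, q.IsRoot z → ‖z‖ = 1)
    (hsq : IsCoprime s q)
    (hωsq : ω = algebraMap ℂ[X] (RatFunc ℂ) s / algebraMap ℂ[X] (RatFunc ℂ) q)
    {u k : Hardy p'} : (u, k) ∈ adjointGraph (toeplitz p ω) ↔
      ∃ (v : Hardy p') (c : ℂ[X]), c.degree < s.natDegree ∧ u = polyMul (sharp q) v ∧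
        polyMul (X ^ q.natDegree) (polyMul (sharp s) v) =
          polyMul (X ^ s.natDegree) k + ofPoly p' c := by
  constructor
  swap
  · rintro ⟨v, c, hc, rfl, heq⟩
    exact mem_adjointGraph_of_eq hq hroot hωsq hc heq
  intro hmem
  obtain ⟨E, hE⟩ := exists_polyMul_sharp_eq_add_ofPoly hq hroot hωsq hmem
  -- Applied to u, the Bézout identity expresses u as a multiple of q^♯ plus the polynomial a E;
  -- reducing a E modulo q^♯ leaves τ.
  obtain ⟨a, b, hab⟩ : IsCoprime (X ^ q.natDegree * sharp s) (sharp q) :=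
    (isCoprime_X_pow (not_isRoot_zero_sharp hq) _).mul_left (isCoprime_sharp hq hsq)
  obtain ⟨v, τ, hτ, hu⟩ : ∃ (v : Hardy p') (τ : ℂ[X]), τ.degree < q.degree ∧
      u = polyMul (sharp q) v + ofPoly p' τ := by
    refine ⟨polyMul (a * X ^ s.natDegree) k + polyMul b u + ofPoly p' (a * E / sharp q),
      a * E % sharp q, (degree_mod_lt _ (sharp_ne_zero hq)).trans_le ?_, ?_⟩
    · rw [degree_eq_natDegree hq, degree_eq_natDegree (sharp_ne_zero hq), Nat.cast_le]
      exact natDegree_sharp_le q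
    · have h1 : ofPoly p' (a * E) = polyMul (sharp q) (ofPoly p' (a * E / sharp q)) +
          ofPoly p' (a * E % sharp q) := by
        conv_lhs => rw [← EuclideanDomain.div_add_mod (a * E) (sharp q)]
        rw [ofPoly, add_polyMul, ← ofPoly, ← ofPoly, polyMul_ofPoly]
      have h2 : polyMul (a * (X ^ q.natDegree * sharp s)) u =
          polyMul (sharp q) (polyMul (a * X ^ s.natDegree) k) + ofPoly p' (a * E) := by
        rw [mul_polyMul, hE, polyMul_add, polyMul_ofPoly, ← mul_polyMul, ← mul_polyMul]
        congr 2
        ring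
      have h3 : polyMul (b * sharp q) u = polyMul (sharp q) (polyMul b u) := by
        rw [mul_comm b, mul_polyMul]
      conv_lhs => rw [← one_polyMul u, ← hab, add_polyMul, h2, h3, h1]
      rw [polyMul_add, polyMul_add]
      abel
  -- Subtracting the pair (q^♯ v, k₀) from the easy direction isolates τ in the domain of the
  -- adjoint relation.
  obtain ⟨k₀, c, hc, heq⟩ := exists_backward_shift s.natDegree
    (polyMul (X ^ q.natDegree) (polyMul (sharp s) v))
  have h0 := Submodule.sub_mem _ hmem (mem_adjointGraph_of_eq hq hroot hωsq hc heq)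
  rw [Prod.mk_sub_mk, hu, add_sub_cancel_left] at h0
  have hτ0 := eq_zero_of_ofPoly_mem_adjointGraph hq hroot hsq hωsq hτ h0
  rw [hτ0, ofPoly_zero] at h0
  have hk := sub_eq_zero.1 (adjointGraph_single_valued hq hroot hωsq h0)
  rw [hτ0, ofPoly_zero, add_zero] at hu
  exact ⟨v, c, hc, hu, by rw [hk, heq]⟩

end Adjoint

end ToeplitzLike

namespace ToeplitzLike

/-! ### The operators with symbols `ω^*` and `z ^ k` -/

section Symbols

variable {ω : RatFunc ℂ} {s q : ℂ[X]} {p : ℝ≥0∞} [Fact (1 ≤ p)]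

/-- Here z ^ (-n) w = k + z ^ (-n) c, and the last term has only negative frequencies. -/
theorem isRieszProj_backward_shift {n : ℕ} {w k : Hardy p} {c : ℂ[X]} (hc : c.degree < n)
    (heq : w = polyMul (X ^ n) k + ofPoly p c) :
    IsRieszProj (memLp_fourier_mul (-n) w).toLp k := by
  intro i hi
  rw [fourierCoeff_congr (MemLp.coeFn_toLp _), fourierCoeff_fourier_mul, heq, coef_add,
    coef_X_pow_polyMul]
  obtain ⟨j, rfl⟩ := Int.eq_ofNat_of_zero_le hi
  have h1 : ((j : ℤ) - -(n : ℤ)) = ((j + n : ℕ) : ℤ) := by push_cast; ring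
  rw [h1, coef_ofPoly_natCast, coeff_eq_zero_of_degree_lt (hc.trans_le (by
    exact_mod_cast Nat.le_add_left n j)), add_zero, coef]
  congr 1
  push_cast
  ring

/-- On the circle ω^* q^♯ v = z ^ (deg q) conj(s) v = z ^ (deg q - deg s) s^♯ v. The poles have
cancelled, so the strictly proper part is zero. -/
theorem mem_toeplitzGraph_star (hq : q ≠ 0)
    (hωsq : ω = algebraMap ℂ[X] (RatFunc ℂ) s / algebraMap ℂ[X] (RatFunc ℂ) q)
    {v k : Hardy p} {c : ℂ[X]} (hc : c.degree < s.natDegree)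
    (heq : polyMul (X ^ q.natDegree) (polyMul (sharp s) v) =
      polyMul (X ^ s.natDegree) k + ofPoly p c) :
    (polyMul (sharp q) v, k) ∈ toeplitzGraph p (star ω) := by
  refine ⟨_, 0, zero_mem_RatT0, ?_, isRieszProj_backward_shift hc heq⟩
  filter_upwards [(memLp_fourier_mul (-s.natDegree)
      (polyMul (X ^ q.natDegree) (polyMul (sharp s) v))).coeFn_toLp,
    eval_denom_ne_zero_ae ω, onCircle_div_ae hq hωsq, ae_pt_not_root hq,
    coeFn_polyMul (sharp q) v, coeFn_polyMul (sharp s) v,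
    coeFn_polyMul (X ^ q.natDegree) (polyMul (sharp s) v)] with t h1 h2 h3 h4 h5 h6 h7
  have h8 : onCircle 0 t = 0 := by simp [onCircle]
  have h9 : (starRingEnd ℂ) (q.eval (pt t)) ≠ 0 := by simpa using h4
  rw [h1, h7, h6, h8, add_zero, onCircle_star ω t h2, h3, h5, sharp_eq_reflect, sharp_eq_reflect,
    eval_map_conj_reflect _ _ le_rfl, eval_map_conj_reflect _ _ le_rfl, map_div₀, eval_pow, eval_X]
  have h10 := fourier_neg_mul_pt_pow s.natDegree t
  field_simp
  linear_combination -(pt t ^ q.natDegree * (starRingEnd ℂ) (s.eval (pt t)) *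
    (v : Lp ℂ p arc) t) * h10

theorem mem_toeplitzGraph_zpow {m n : ℕ} {w k : Hardy p} {c : ℂ[X]} (hc : c.degree < n)
    (heq : polyMul (X ^ m) w = polyMul (X ^ n) k + ofPoly p c) :
    (w, k) ∈ toeplitzGraph p (RatFunc.X ^ ((m : ℤ) - (n : ℤ))) := by
  refine ⟨_, 0, zero_mem_RatT0, ?_, isRieszProj_backward_shift hc heq⟩
  have hX : (RatFunc.X : RatFunc ℂ) ^ ((m : ℤ) - (n : ℤ)) =
      algebraMap ℂ[X] (RatFunc ℂ) (X ^ m) / algebraMap ℂ[X] (RatFunc ℂ) (X ^ n) := by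
    rw [zpow_sub₀ RatFunc.X_ne_zero, zpow_natCast, zpow_natCast, map_pow, map_pow,
      RatFunc.algebraMap_X]
  filter_upwards [(memLp_fourier_mul (-n) (polyMul (X ^ m) w)).coeFn_toLp,
    onCircle_div_ae (pow_ne_zero n X_ne_zero) hX, coeFn_polyMul (X ^ m) w] with t h1 h2 h3
  have h8 : onCircle 0 t = 0 := by simp [onCircle]
  have h10 := fourier_neg_mul_pt_pow n t
  have h11 : pt t ≠ 0 := norm_pos_iff.1 (by rw [norm_pt]; exact one_pos)
  rw [h1, h2, h3, h8, add_zero, eval_pow, eval_pow, eval_X, div_mul_eq_mul_div,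
    div_eq_iff (pow_ne_zero n h11)]
  linear_combination -((w : Lp ℂ p arc) t * pt t ^ m) * h10

end Symbols

/-! ### The kernel of the adjoint -/

section Kernel

theorem mem_kernel_iff {p : ℝ≥0∞} [Fact (1 ≤ p)] {A : Hardy p →ₗ.[ℂ] Hardy p} {u : Hardy p} :
    u ∈ kernel A ↔ (u, 0) ∈ A.graph := by
  rw [kernel, Submodule.mem_map, LinearPMap.mem_graph_iff]
  constructor
  · rintro ⟨y, hy, rfl⟩
    exact ⟨y, rfl, hy⟩
  · rintro ⟨y, rfl, hy⟩
    exact ⟨y, hy, rfl⟩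

theorem injective_iff_kernel_eq_bot {p : ℝ≥0∞} [Fact (1 ≤ p)] (A : Hardy p →ₗ.[ℂ] Hardy p) :
    Function.Injective A ↔ kernel A = ⊥ := by
  rw [kernel, ← Submodule.map_bot A.domain.subtype,
    (Submodule.map_injective_of_injective A.domain.injective_subtype).eq_iff, LinearMap.ker_eq_bot]
  rfl

/-- The reciprocal of a polynomial without roots in the closed disc, in the Hardy space. -/
theorem exists_polyMul_eq_one (p : ℝ≥0∞) [Fact (1 ≤ p)] {b : ℂ[X]} (hb : b ≠ 0)
    (hroot : ∀ z, b.IsRoot z → 1 < ‖z‖) : ∃ e : Hardy p, polyMul b e = Hardy.one p := by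
  have hne : ∀ t, b.eval (pt t) ≠ 0 := fun t h => by
    have := hroot _ h
    rw [norm_pt] at this
    exact lt_irrefl _ this
  have hcont : Continuous fun t => (b.eval (pt t))⁻¹ := (b.continuous.comp continuous_pt).inv₀ hne
  obtain ⟨K, hK⟩ := isCompact_univ.exists_bound_of_continuousOn hcont.continuousOn
  have hmem : MemLp (fun t => (b.eval (pt t))⁻¹) p arc :=
    MemLp.of_bound hcont.aestronglyMeasurable K (Filter.Eventually.of_forall fun t => hK t trivial)
  have hone : (fun t => b.eval (pt t) * (hmem.toLp : Lp ℂ p arc) t) =ᵐ[arc] (Hardy.one p : Lp ℂ p arc) := by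
    filter_upwards [hmem.coeFn_toLp, coeFn_one (p := p)] with t h1 h2
    rw [h1, h2, mul_inv_cancel₀ (hne t)]
  have hneg : hmem.toLp ∈ Hardy p := by
    -- Analyticity of 1 / b is inherited from the product b · (1 / b) = 1.
    refine fourierCoeff_neg_eq_zero_of_polyMul _ _ b rfl hb (fun z hz => (hroot z hz).le) ?_
    intro n hn
    rw [fourierCoeff_congr hone]
    exact coef_of_neg _ hn
  exact ⟨⟨_, hneg⟩, Hardy.ext_ae ((coeFn_polyMul b _).trans hone)⟩

theorem isRoot_sharp_norm_gt {a : ℂ[X]} (ha : a ≠ 0) (h : ∀ z, a.IsRoot z → ‖z‖ < 1) (z : ℂ)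
    (hz : (sharp a).IsRoot z) : 1 < ‖z‖ := by
  obtain ⟨w, hw, hwz, hpos⟩ := norm_of_isRoot_sharp ha hz
  have := h w hw
  rw [hwz] at this
  exact (inv_lt_one₀ hpos).1 this

theorem isRoot_sharp_norm_le {a : ℂ[X]} (ha : a ≠ 0) (h : ∀ z, a.IsRoot z → 1 ≤ ‖z‖) (z : ℂ)
    (hz : (sharp a).IsRoot z) : ‖z‖ ≤ 1 := by
  obtain ⟨w, hw, hwz, hpos⟩ := norm_of_isRoot_sharp ha hz
  have := h w hw
  rw [hwz] at this
  exact (one_le_inv₀ hpos).1 this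

theorem isRoot_sharp_norm_eq {a : ℂ[X]} (ha : a ≠ 0) (h : ∀ z, a.IsRoot z → ‖z‖ = 1) (z : ℂ)
    (hz : (sharp a).IsRoot z) : ‖z‖ = 1 := by
  obtain ⟨w, hw, hwz, hpos⟩ := norm_of_isRoot_sharp ha hz
  have := h w hw
  rw [hwz] at this
  exact inv_eq_one.1 this

/-- Matches the truncated difference, suited to counting dimensions, with the degree condition of
the kernel formula. Both sides hold for r = 0, whose degree is ⊥. -/
theorem degree_lt_sub_iff {r q a : ℂ[X]} (hq : q ≠ 0) (ha : a ≠ 0) :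
    r.degree < ((a.natDegree - q.natDegree : ℕ) : WithBot ℕ) ↔ r.degree + q.degree < a.degree := by
  by_cases hr : r = 0
  · simp [hr, bot_lt_iff_ne_bot, ha]
  · rw [degree_eq_natDegree hr, degree_eq_natDegree hq, degree_eq_natDegree ha, ← Nat.cast_add,
      Nat.cast_lt, Nat.cast_lt]
    omega

variable {p p' : ℝ≥0∞} [Fact (1 ≤ p)] [Fact (1 ≤ p')] [ENNReal.HolderConjugate p p']
  {ω : RatFunc ℂ} {s q : ℂ[X]}

/-- The null space of the adjoint relation; `a` carries the roots of `s` in the open disc, and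
`e` is the function `1 / a^♯`. -/
theorem mem_adjointGraph_zero_iff (hq : q ≠ 0) (hroot : ∀ z, q.IsRoot z → ‖z‖ = 1)
    (hsq : IsCoprime s q)
    (hωsq : ω = algebraMap ℂ[X] (RatFunc ℂ) s / algebraMap ℂ[X] (RatFunc ℂ) q)
    {a b : ℂ[X]} (hs : s = a * b) (ha : a ≠ 0) (hb : b ≠ 0) (hbroot : ∀ z, b.IsRoot z → 1 ≤ ‖z‖)
    {e : Hardy p'} (he : polyMul (sharp a) e = Hardy.one p') {u : Hardy p'} :
    (u, 0) ∈ adjointGraph (toeplitz p ω) ↔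
      ∃ r : ℂ[X], r.degree < ((a.natDegree - q.natDegree : ℕ) : WithBot ℕ) ∧
        u = polyMul (sharp q * r) e := by
  have hb0 : b.coeff 0 ≠ 0 := fun h => by
    rw [coeff_zero_eq_eval_zero] at h
    have := hbroot 0 h
    rw [norm_zero] at this
    exact absurd this (by norm_num)
  have hdeg : s.natDegree = a.natDegree + b.natDegree := by rw [hs, natDegree_mul ha hb]
  rw [mem_adjointGraph_toeplitz_iff hq hroot hsq hωsq]
  constructor
  · rintro ⟨v, c, hc, rfl, heq⟩
    rw [polyMul_zero, zero_add] at heq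
    have hX : (X ^ q.natDegree * sharp b) ≠ 0 :=
      mul_ne_zero (pow_ne_zero _ X_ne_zero) (sharp_ne_zero hb)
    have hW : polyMul (X ^ q.natDegree * sharp b) (polyMul (sharp a) v) = ofPoly p' c := by
      rw [← heq, hs, sharp_mul, ← mul_polyMul, ← mul_polyMul]
      congr 1
      ring
    -- The divisor z ^ m b^♯ has degree exactly m + deg b, since b does not vanish at 0, and c has
    -- degree below deg a + deg b. If deg a ≤ m, no frequency is left and r = 0.
    obtain ⟨r, hr, hrv⟩ := exists_ofPoly_of_coef_eq_zero (polyMul (sharp a) v)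
      (a.natDegree - q.natDegree) fun n hn => by
        refine fourierCoeff_ge_eq_zero_of_polyMul _ _ (X ^ q.natDegree * sharp b) s.natDegree rfl
          hX ?_ ?_ n ?_
        · intro z hz
          rcases root_mul.1 hz with hz | hz
          · rw [IsRoot, eval_pow, eval_X] at hz
            rw [eq_zero_of_pow_eq_zero hz]
            simp
          · exact isRoot_sharp_norm_le hb hbroot z hz
        · intro i hi
          rw [← coef_polyMul, hW]
          obtain ⟨j, rfl⟩ := Int.eq_ofNat_of_zero_le (by omega : 0 ≤ i)
          rw [coef_ofPoly_natCast]
          exact coeff_eq_zero_of_degree_lt (hc.trans_le (by exact_mod_cast hi))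
        · rw [natDegree_mul (pow_ne_zero _ X_ne_zero) (sharp_ne_zero hb), natDegree_X_pow,
            natDegree_sharp hb0]
          omega
    refine ⟨r, hr, ?_⟩
    rw [mul_polyMul]
    congr 1
    refine polyMul_injective (sharp_ne_zero ha) ?_
    rw [hrv, polyMul_left_comm, he, ofPoly]
  · rintro ⟨r, hr, rfl⟩
    -- As a^♯ e = 1, the choice v = r / a^♯ leaves z ^ m b^♯ r, of degree less than n; a nonzero r
    -- forces deg a > m.
    refine ⟨polyMul r e, X ^ q.natDegree * sharp b * r, ?_, mul_polyMul _ _ _, ?_⟩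
    · by_cases hr0 : r = 0
      · rw [hr0, mul_zero, degree_zero]
        exact WithBot.bot_lt_coe _
      rw [degree_eq_natDegree hr0, Nat.cast_lt] at hr
      refine (degree_le_natDegree).trans_lt ?_
      rw [Nat.cast_lt]
      refine (natDegree_mul_le).trans_lt ?_
      have h1 := natDegree_mul_le (p := X ^ q.natDegree) (q := sharp b)
      rw [natDegree_X_pow] at h1
      have h2 := natDegree_sharp_le b
      omega
    · rw [polyMul_zero, zero_add, hs, sharp_mul, mul_comm (sharp a), mul_polyMul,
        polyMul_left_comm (sharp a), he, ← ofPoly, polyMul_ofPoly, polyMul_ofPoly, mul_assoc]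

/-- The elements `(b r) e` of the Hardy space for polynomials `r` of degree less than `N`. -/
noncomputable def polyFamily (p : ℝ≥0∞) [Fact (1 ≤ p)] (b : ℂ[X]) (e : Hardy p) (N : ℕ) :
    degreeLT ℂ N →ₗ[ℂ] Hardy p where
  toFun r := polyMul (b * r) e
  map_add' r r' := by rw [Submodule.coe_add, mul_add, add_polyMul]
  map_smul' c r := by rw [Submodule.coe_smul, mul_smul_comm, smul_polyMul, RingHom.id_apply]

/-- Multiplication by a replaces e by 1 and leaves an identity between polynomials. -/
theorem polyFamily_injective {p : ℝ≥0∞} [Fact (1 ≤ p)] {a b : ℂ[X]} (hb : b ≠ 0) {e : Hardy p}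
    (he : polyMul a e = Hardy.one p) (N : ℕ) : Function.Injective (polyFamily p b e N) := by
  intro r r' h
  have h1 := congrArg (polyMul a) (show polyMul (b * r) e = polyMul (b * r') e from h)
  rw [polyMul_left_comm, polyMul_left_comm a, he] at h1
  exact Subtype.ext (mul_left_cancel₀ hb (ofPoly_injective (p := p) h1))

theorem finrank_of_mem_iff {p : ℝ≥0∞} [Fact (1 ≤ p)] {a b : ℂ[X]} (hb : b ≠ 0) {e : Hardy p}
    (he : polyMul a e = Hardy.one p) {N : ℕ} {K : Submodule ℂ (Hardy p)}
    (hK : ∀ u, u ∈ K ↔ ∃ r : ℂ[X], r.degree < (N : WithBot ℕ) ∧ u = polyMul (b * r) e) :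
    FiniteDimensional ℂ K ∧ Module.finrank ℂ K = N := by
  have hrange : K = LinearMap.range (polyFamily p b e N) := by
    ext u
    rw [hK, LinearMap.mem_range]
    constructor
    · rintro ⟨r, hr, rfl⟩
      exact ⟨⟨r, mem_degreeLT.2 hr⟩, rfl⟩
    · rintro ⟨r, rfl⟩
      exact ⟨r, mem_degreeLT.1 r.2, rfl⟩
  have hfin : FiniteDimensional ℂ (degreeLT ℂ N) := (degreeLTEquiv ℂ N).symm.finiteDimensional
  rw [hrange, LinearMap.finrank_range_of_inj (polyFamily_injective hb he N),
    (degreeLTEquiv ℂ N).finrank_eq, Module.finrank_fin_fun]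
  exact ⟨inferInstance, rfl⟩

end Kernel

end ToeplitzLike

namespace ToeplitzLike

/-! ### Counting zeros and poles -/

section Counting

theorem exists_factorization_roots (P : ℂ → Prop) {s : ℂ[X]} (hs : s ≠ 0) :
    ∃ a b : ℂ[X], s = a * b ∧ (∀ z, a.IsRoot z → P z) ∧ ∀ z, b.IsRoot z → ¬ P z := by
  classical
  have hprod : ∀ (m : Multiset ℂ) (z : ℂ),
      (m.map fun x => (X - C x : ℂ[X])).prod.IsRoot z → z ∈ m := by
    intro m z hz
    rw [← mem_roots (monic_multiset_prod_of_monic _ _ fun x _ => monic_X_sub_C x).ne_zero,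
      roots_multiset_prod_X_sub_C] at hz
    exact hz
  refine ⟨((s.roots.filter P).map fun x => X - C x).prod,
    C s.leadingCoeff * ((s.roots.filter fun x => ¬ P x).map fun x => X - C x).prod, ?_, ?_, ?_⟩
  · conv_lhs => rw [(IsAlgClosed.splits s).eq_prod_roots, ← Multiset.filter_add_not P s.roots,
      Multiset.map_add, Multiset.prod_add]
    ring
  · intro z hz
    exact (Multiset.mem_filter.1 (hprod _ z hz)).2
  · intro z hz
    rcases root_mul.1 hz with hz | hz
    · rw [IsRoot, eval_C, leadingCoeff_eq_zero] at hz
      exact absurd hz hs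
    · exact (Multiset.mem_filter.1 (hprod _ z hz)).2

theorem exists_factorization_disc {s : ℂ[X]} (hs : s ≠ 0) :
    ∃ a b : ℂ[X], s = a * b ∧ (∀ z, a.IsRoot z → ‖z‖ < 1) ∧ ∀ z, b.IsRoot z → 1 ≤ ‖z‖ := by
  obtain ⟨a, b, hab, ha, hb⟩ := exists_factorization_roots (fun z => ‖z‖ < 1) hs
  exact ⟨a, b, hab, ha, fun z hz => not_lt.1 (hb z hz)⟩

theorem countP_roots_of_forall (P : ℂ → Prop) [DecidablePred P] {a : ℂ[X]} (ha : a ≠ 0)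
    (h : ∀ z, a.IsRoot z → P z) : a.roots.countP P = a.natDegree := by
  rw [Multiset.countP_eq_card.2 fun z hz => h z ((mem_roots ha).1 hz),
    (IsAlgClosed.splits a).natDegree_eq_card_roots]

theorem countP_roots_of_forall_not (P : ℂ → Prop) [DecidablePred P] {a : ℂ[X]} (ha : a ≠ 0)
    (h : ∀ z, a.IsRoot z → ¬ P z) : a.roots.countP P = 0 :=
  Multiset.countP_eq_zero.2 fun z hz => h z ((mem_roots ha).1 hz)

theorem natDegree_eq_of_associated {a b : ℂ[X]} (h : Associated a b) :
    a.natDegree = b.natDegree := by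
  rw [(IsAlgClosed.splits a).natDegree_eq_card_roots, h.roots_eq,
    ← (IsAlgClosed.splits b).natDegree_eq_card_roots]

variable {ω : RatFunc ℂ}

theorem zerosInside_eq {s a b : ℂ[X]} (h : Associated ω.num s) (hs : s = a * b)
    (ha0 : a ≠ 0) (hb0 : b ≠ 0)
    (ha : ∀ z, a.IsRoot z → ‖z‖ < 1) (hb : ∀ z, b.IsRoot z → 1 ≤ ‖z‖) :
    zerosInside ω = a.natDegree := by
  rw [zerosInside, h.roots_eq, hs, roots_mul (mul_ne_zero ha0 hb0), Multiset.countP_add,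
    countP_roots_of_forall _ ha0 ha, countP_roots_of_forall_not _ hb0 fun z hz => (hb z hz).not_gt,
    add_zero]

theorem polesOnCircle_eq {q : ℂ[X]} (h : Associated ω.denom q) (hω : ω ∈ RatT) :
    polesOnCircle ω = q.natDegree := by
  rw [polesOnCircle, countP_roots_of_forall _ ω.denom_ne_zero hω, natDegree_eq_of_associated h]

/-- Numerator and denominator of `ω^*`, up to a common constant factor. -/
theorem associated_star (hω0 : ω ≠ 0) :
    ∃ i j : ℕ, i + ω.num.natDegree = j + ω.denom.natDegree ∧
      Associated (star ω).num (X ^ i * sharp ω.num) ∧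
      Associated (star ω).denom (X ^ j * sharp ω.denom) := by
  have hn : ω.num ≠ 0 := RatFunc.num_ne_zero hω0
  set N := max ω.num.natDegree ω.denom.natDegree with hN
  obtain ⟨i, hi⟩ : ∃ i, N = i + ω.num.natDegree :=
    ⟨N - ω.num.natDegree, (Nat.sub_add_cancel (le_max_left _ _)).symm⟩
  obtain ⟨j, hj⟩ : ∃ j, N = j + ω.denom.natDegree :=
    ⟨N - ω.denom.natDegree, (Nat.sub_add_cancel (le_max_right _ _)).symm⟩
  have hA : (ω.num.map (starRingEnd ℂ)).reflect N = X ^ i * sharp ω.num := by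
    rw [hi, reflect_conj_add]
  have hB : (ω.denom.map (starRingEnd ℂ)).reflect N = X ^ j * sharp ω.denom := by
    rw [hj, reflect_conj_add]
  have hstar : star ω = algebraMap ℂ[X] (RatFunc ℂ) (X ^ i * sharp ω.num) /
      algebraMap ℂ[X] (RatFunc ℂ) (X ^ j * sharp ω.denom) := by
    rw [← hA, ← hB]
    rfl
  have hB0 : X ^ j * sharp ω.denom ≠ 0 :=
    mul_ne_zero (pow_ne_zero _ X_ne_zero) (sharp_ne_zero ω.denom_ne_zero)
  have hXd := isCoprime_X_pow (not_isRoot_zero_sharp ω.denom_ne_zero)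
  have hXn := isCoprime_X_pow (not_isRoot_zero_sharp hn)
  have hcop : IsCoprime (X ^ i * sharp ω.num) (X ^ j * sharp ω.denom) := by
    refine IsCoprime.mul_left (IsCoprime.mul_right ?_ (hXd i)) (IsCoprime.mul_right (hXn j).symm
      (isCoprime_sharp ω.denom_ne_zero ω.isCoprime_num_denom))
    -- N is the larger of the two degrees, so one of the powers of z is trivial and nothing cancels
    -- between them.
    have h0 : i = 0 ∨ j = 0 := by omega
    rcases h0 with rfl | rfl
    · rw [pow_zero]; exact isCoprime_one_left
    · rw [pow_zero]; exact isCoprime_one_right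
  exact ⟨i, j, hi ▸ hj, associated_num hB0 hcop hstar, associated_denom hB0 hcop hstar⟩

theorem polesOnCircle_star (hω : ω ∈ RatT) (hω0 : ω ≠ 0) :
    polesOnCircle (star ω) = ω.denom.natDegree := by
  obtain ⟨i, j, -, -, hB⟩ := associated_star hω0
  have hq0 : ω.denom.coeff 0 ≠ 0 := fun h => by
    rw [coeff_zero_eq_eval_zero] at h
    simpa using hω 0 h
  have hX : (X ^ j : ℂ[X]) ≠ 0 := pow_ne_zero _ X_ne_zero
  rw [polesOnCircle, hB.roots_eq, roots_mul (mul_ne_zero hX (sharp_ne_zero ω.denom_ne_zero)),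
    Multiset.countP_add, countP_roots_of_forall_not _ hX fun z hz => ?_,
    countP_roots_of_forall _ (sharp_ne_zero ω.denom_ne_zero)
      (isRoot_sharp_norm_eq ω.denom_ne_zero hω), natDegree_sharp hq0, zero_add]
  rw [IsRoot, eval_pow, eval_X] at hz
  simp [eq_zero_of_pow_eq_zero hz]

/-- With a carrying the zeros of ω inside the disc, a^♯ contributes deg a^♯ zeros outside the closed
disc. The order at infinity is deg a - deg a^♯, the multiplicity of the root of a at 0, and the sum
is deg a. -/
theorem zerosOutside_star (hω : ω ∈ RatT) (hω0 : ω ≠ 0) :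
    zerosOutside (star ω) = zerosInside ω := by
  obtain ⟨i, j, hij, hA, hB⟩ := associated_star hω0
  obtain ⟨a, b, hab, ha, hb⟩ := exists_factorization_disc (RatFunc.num_ne_zero hω0)
  have hab0 : a * b ≠ 0 := hab ▸ RatFunc.num_ne_zero hω0
  have ha0 := left_ne_zero_of_mul hab0
  have hb0 := right_ne_zero_of_mul hab0
  have hq0 : ω.denom.coeff 0 ≠ 0 := fun h => by
    rw [coeff_zero_eq_eval_zero] at h
    simpa using hω 0 h
  have hbc : b.coeff 0 ≠ 0 := fun h => by
    rw [coeff_zero_eq_eval_zero] at h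
    have := hb 0 h
    rw [norm_zero] at this
    exact absurd this (by norm_num)
  have hX : ∀ k, (X ^ k : ℂ[X]) ≠ 0 := fun k => pow_ne_zero _ X_ne_zero
  have hsa := sharp_ne_zero ha0
  have hsb := sharp_ne_zero hb0
  rw [zerosInside_eq (Associated.refl _) hab ha0 hb0 ha hb, zerosOutside,
    natDegree_eq_of_associated hA, natDegree_eq_of_associated hB, hA.roots_eq, hab, sharp_mul,
    roots_mul (mul_ne_zero (hX i) (mul_ne_zero hsa hsb)), roots_mul (mul_ne_zero hsa hsb),
    Multiset.countP_add, Multiset.countP_add, countP_roots_of_forall_not _ (hX i) fun z hz => ?_,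
    countP_roots_of_forall _ hsa (isRoot_sharp_norm_gt ha0 ha),
    countP_roots_of_forall_not _ hsb fun z hz => (isRoot_sharp_norm_le hb0 hb z hz).not_gt,
    natDegree_mul (hX i) (mul_ne_zero hsa hsb), natDegree_mul hsa hsb,
    natDegree_mul (hX j) (sharp_ne_zero ω.denom_ne_zero), natDegree_X_pow, natDegree_X_pow,
    natDegree_sharp hq0, natDegree_sharp hbc]
  · have h1 := natDegree_sharp_le a
    rw [hab, natDegree_mul ha0 hb0] at hij
    omega
  · rw [IsRoot, eval_pow, eval_X] at hz
    rw [eq_zero_of_pow_eq_zero hz, norm_zero]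
    norm_num

end Counting

end ToeplitzLike

/-! ### Assembly of the theorem from the description of the adjoint relation -/

open ToeplitzLike in
theorem theorem3p1 (p p' : ℝ≥0∞) [Fact (1 ≤ p)] [Fact (1 ≤ p')] [ENNReal.HolderConjugate p p']
    (hp1 : 1 < p) (hp : p < ∞)
    (ω : RatFunc ℂ) (hω : ω ∈ ToeplitzLike.RatT)
    (s q : ℂ[X]) (hq : q ≠ 0) (hsq : IsCoprime s q)
    (hωsq : ω = algebraMap ℂ[X] (RatFunc ℂ) s / algebraMap ℂ[X] (RatFunc ℂ) q) :
    -- the adjoint is a well-defined operator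
    (ToeplitzLike.adjoint p p' (ToeplitzLike.toeplitz p ω)).graph =
        ToeplitzLike.adjointGraph (ToeplitzLike.toeplitz p ω) ∧
    -- domain of the adjoint, and restriction of the operator with symbol `ω^*`
    ((ToeplitzLike.adjoint p p' (ToeplitzLike.toeplitz p ω)).domain : Set (ToeplitzLike.Hardy p')) =
        Set.range (ToeplitzLike.polyMul (ToeplitzLike.sharp q)) ∧
    ToeplitzLike.adjoint p p' (ToeplitzLike.toeplitz p ω) ≤
        ToeplitzLike.toeplitz p' (ToeplitzLike.star ω) ∧
    -- action of the adjoint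
    (∀ v : ToeplitzLike.Hardy p',
      ∃ (h₁ : ToeplitzLike.polyMul (ToeplitzLike.sharp q) v ∈
          (ToeplitzLike.adjoint p p' (ToeplitzLike.toeplitz p ω)).domain)
        (h₂ : ToeplitzLike.polyMul (ToeplitzLike.sharp s) v ∈
          (ToeplitzLike.toeplitz p' (RatFunc.X ^ ((q.natDegree : ℤ) - (s.natDegree : ℤ)))).domain),
        ToeplitzLike.adjoint p p' (ToeplitzLike.toeplitz p ω)
            ⟨ToeplitzLike.polyMul (ToeplitzLike.sharp q) v, h₁⟩ =
          ToeplitzLike.toeplitz p' (RatFunc.X ^ ((q.natDegree : ℤ) - (s.natDegree : ℤ)))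
            ⟨ToeplitzLike.polyMul (ToeplitzLike.sharp s) v, h₂⟩) ∧
    -- range of the adjoint
    Set.range (ToeplitzLike.adjoint p p' (ToeplitzLike.toeplitz p ω)) =
      {k | ∃ (v : ToeplitzLike.Hardy p')
          (h : ToeplitzLike.polyMul (ToeplitzLike.sharp s) v ∈
            (ToeplitzLike.toeplitz p' (RatFunc.X ^ ((q.natDegree : ℤ) - (s.natDegree : ℤ)))).domain),
          k = ToeplitzLike.toeplitz p' (RatFunc.X ^ ((q.natDegree : ℤ) - (s.natDegree : ℤ)))
            ⟨ToeplitzLike.polyMul (ToeplitzLike.sharp s) v, h⟩} ∧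
    -- kernel of the adjoint, as a set of functions on the circle
    (∀ sm s0 sp : ℂ[X], s = sm * s0 * sp →
      (∀ z : ℂ, sm.IsRoot z → ‖z‖ < 1) → (∀ z : ℂ, s0.IsRoot z → ‖z‖ = 1) →
      (∀ z : ℂ, sp.IsRoot z → 1 < ‖z‖) →
      (fun g : ToeplitzLike.Hardy p' =>
          (((g : Lp ℂ p' ToeplitzLike.arc)) : ToeplitzLike.Torus →ₘ[ToeplitzLike.arc] ℂ)) ''
          (ToeplitzLike.kernel (ToeplitzLike.adjoint p p' (ToeplitzLike.toeplitz p ω)) :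
            Set (ToeplitzLike.Hardy p')) =
        {x | ∃ r : ℂ[X], r.degree + q.degree < sm.degree ∧
          x = ToeplitzLike.circleClass
            (algebraMap ℂ[X] (RatFunc ℂ) (ToeplitzLike.sharp q * r) /
              algebraMap ℂ[X] (RatFunc ℂ) (ToeplitzLike.sharp sm))}) ∧
    -- dimension of the kernel, and injectivity
    (ω ≠ 0 →
      FiniteDimensional ℂ
        (ToeplitzLike.kernel (ToeplitzLike.adjoint p p' (ToeplitzLike.toeplitz p ω))) ∧
      (Module.finrank ℂ
        (ToeplitzLike.kernel (ToeplitzLike.adjoint p p' (ToeplitzLike.toeplitz p ω))) : ℤ) =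
        max 0 ((ToeplitzLike.zerosOutside (ToeplitzLike.star ω) : ℤ) -
          (ToeplitzLike.polesOnCircle (ToeplitzLike.star ω) : ℤ)) ∧
      (Function.Injective (ToeplitzLike.adjoint p p' (ToeplitzLike.toeplitz p ω)) ↔
        ToeplitzLike.zerosInside ω ≤ ToeplitzLike.polesOnCircle ω)) := by
  have hdq := associated_denom hq hsq hωsq
  have hns := associated_num hq hsq hωsq
  have hroot : ∀ z, q.IsRoot z → ‖z‖ = 1 := fun z hz => hω z (hz.dvd hdq.symm.dvd)
  have hgraph : (adjoint p p' (toeplitz p ω)).graph = adjointGraph (toeplitz p ω) := by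
    refine Submodule.toLinearPMap_graph_eq _ ?_
    rintro ⟨u, k⟩ hmem hu
    simp only at hu
    subst hu
    exact adjointGraph_single_valued hq hroot hωsq hmem
  have hiff := fun u k : Hardy p' => (SetLike.ext_iff.1 hgraph (u, k)).trans
    (mem_adjointGraph_toeplitz_iff hq hroot hsq hωsq)
  have hshift := fun v : Hardy p' => exists_backward_shift s.natDegree
    (polyMul (X ^ q.natDegree) (polyMul (sharp s) v))
  have haction : ∀ v : Hardy p',
      ∃ (h₁ : polyMul (sharp q) v ∈ (adjoint p p' (toeplitz p ω)).domain)
        (h₂ : polyMul (sharp s) v ∈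
          (toeplitz p' (RatFunc.X ^ ((q.natDegree : ℤ) - (s.natDegree : ℤ)))).domain),
        adjoint p p' (toeplitz p ω) ⟨polyMul (sharp q) v, h₁⟩ =
          toeplitz p' (RatFunc.X ^ ((q.natDegree : ℤ) - (s.natDegree : ℤ)))
            ⟨polyMul (sharp s) v, h₂⟩ := by
    intro v
    -- The same backward shift k is the value of both operators.
    obtain ⟨k, c, hc, heq⟩ := hshift v
    have hg₁ := (hiff _ k).2 ⟨v, c, hc, rfl, heq⟩
    have hg₂ := mem_toeplitzGraph_zpow hc heq
    rw [← graph_toeplitz] at hg₂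
    have h₁ := LinearPMap.mem_domain_iff.2 ⟨k, hg₁⟩
    have h₂ := LinearPMap.mem_domain_iff.2 ⟨k, hg₂⟩
    exact ⟨h₁, h₂, ((LinearPMap.image_iff h₁).2 hg₁).symm.trans ((LinearPMap.image_iff h₂).2 hg₂)⟩
  have hdomain : ((adjoint p p' (toeplitz p ω)).domain : Set (Hardy p')) =
      Set.range (polyMul (sharp q)) := by
    ext u
    constructor
    · intro hu
      obtain ⟨k, hk⟩ := LinearPMap.mem_domain_iff.1 hu
      obtain ⟨v, -, -, rfl, -⟩ := (hiff _ _).1 hk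
      exact ⟨v, rfl⟩
    · rintro ⟨v, rfl⟩
      exact (haction v).1
  refine ⟨hgraph, hdomain, ?_, haction, ?_, ?_, ?_⟩
  · rw [← LinearPMap.le_graph_iff, graph_toeplitz]
    rintro ⟨u, k⟩ hmem
    obtain ⟨v, c, hc, rfl, heq⟩ := (hiff _ _).1 hmem
    exact mem_toeplitzGraph_star hq hωsq hc heq
  · ext k
    constructor
    · rintro ⟨⟨u, hu⟩, rfl⟩
      obtain ⟨v, rfl⟩ := hdomain.subset hu
      obtain ⟨_, h₂, heq⟩ := haction v
      exact ⟨v, h₂, heq⟩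
    · rintro ⟨v, _, rfl⟩
      obtain ⟨h₁, _, heq⟩ := haction v
      exact ⟨⟨_, h₁⟩, heq⟩
  · intro sm s0 sp hs hsm hs0 hsp
    -- Every point is a root of the zero polynomial, so each root condition rules it out at a
    -- suitable point: 1 for `sm`, 0 for `s0` and `sp`.
    have hsm0 : sm ≠ 0 := by
      rintro rfl
      exact absurd (hsm 1 (by simp)) (by simp)
    have hs00 : s0 ≠ 0 := by
      rintro rfl
      exact absurd (hs0 0 (by simp)) (by simp)
    have hsp0 : sp ≠ 0 := by
      rintro rfl
      exact absurd (hsp 0 (by simp)) (by norm_num)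
    obtain ⟨e, he⟩ := exists_polyMul_eq_one p' (sharp_ne_zero hsm0) (isRoot_sharp_norm_gt hsm0 hsm)
    have hrest : ∀ z, (s0 * sp).IsRoot z → 1 ≤ ‖z‖ := by
      intro z hz
      rcases root_mul.1 hz with hz | hz
      exacts [(hs0 z hz).ge, (hsp z hz).le]
    have hker := fun u : Hardy p' => mem_kernel_iff.trans ((SetLike.ext_iff.1 hgraph (u, 0)).trans
      (mem_adjointGraph_zero_iff hq hroot hsq hωsq (hs.trans (mul_assoc _ _ _)) hsm0
        (mul_ne_zero hs00 hsp0) hrest he))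
    have hclass : ∀ r : ℂ[X],
        (((polyMul (sharp q * r) e : Hardy p') : Lp ℂ p' arc) : Torus →ₘ[arc] ℂ) =
          circleClass (algebraMap ℂ[X] (RatFunc ℂ) (sharp q * r) /
            algebraMap ℂ[X] (RatFunc ℂ) (sharp sm)) := by
      intro r
      refine AEEqFun.ext ?_
      have he' : ((polyMul (sharp sm) e : Hardy p') : Lp ℂ p' arc) =ᵐ[arc]
        (Hardy.one p' : Hardy p') := by rw [he]
      filter_upwards [coeFn_polyMul (sharp q * r) e, coeFn_polyMul (sharp sm) e, he',
        coeFn_one (p := p'), ae_pt_not_root (sharp_ne_zero hsm0),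
        onCircle_div_ae (s := sharp q * r) (sharp_ne_zero hsm0) rfl,
        AEEqFun.coeFn_mk _ (aestronglyMeasurable_onCircle
          (algebraMap ℂ[X] (RatFunc ℂ) (sharp q * r) / algebraMap ℂ[X] (RatFunc ℂ) (sharp sm)))]
        with t h1 h2 h3 h4 h5 h6 h7
      rw [circleClass, h7, h6]
      refine h1.trans ?_
      rw [h2, h4] at h3
      rw [eq_div_iff h5, mul_assoc, mul_comm _ (eval (pt t) (sharp sm)), h3, mul_one]
    ext x
    constructor
    · rintro ⟨u, hu, rfl⟩
      obtain ⟨r, hr, rfl⟩ := (hker u).1 hu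
      exact ⟨r, (degree_lt_sub_iff hq hsm0).1 hr, hclass r⟩
    · rintro ⟨r, hr, rfl⟩
      exact ⟨_, (hker _).2 ⟨r, (degree_lt_sub_iff hq hsm0).2 hr, rfl⟩, hclass r⟩
  · intro hω0
    have hs0 : s ≠ 0 := by
      rintro rfl
      rw [map_zero, zero_div] at hωsq
      exact hω0 hωsq
    obtain ⟨a, b, hab, ha, hb⟩ := exists_factorization_disc hs0
    have hab0 : a * b ≠ 0 := hab ▸ hs0
    have ha0 := left_ne_zero_of_mul hab0
    have hb0 := right_ne_zero_of_mul hab0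
    obtain ⟨e, he⟩ := exists_polyMul_eq_one p' (sharp_ne_zero ha0) (isRoot_sharp_norm_gt ha0 ha)
    obtain ⟨hfin, hrank⟩ := finrank_of_mem_iff (sharp_ne_zero hq) he
      (K := kernel (adjoint p p' (toeplitz p ω))) fun u => by
        rw [mem_kernel_iff, hgraph]
        exact mem_adjointGraph_zero_iff hq hroot hsq hωsq hab ha0 hb0 hb he
    -- The dimension is the truncated difference of deg a and deg q; truncation is the maximum with
    -- 0, and the value is zero iff deg a ≤ deg q.
    refine ⟨hfin, ?_, ?_⟩
    · rw [hrank, zerosOutside_star hω hω0, polesOnCircle_star hω hω0,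
        zerosInside_eq hns hab ha0 hb0 ha hb, natDegree_eq_of_associated hdq]
      omega
    · rw [injective_iff_kernel_eq_bot, ← Submodule.finrank_eq_zero (R := ℂ), hrank,
        zerosInside_eq hns hab ha0 hb0 ha hb, polesOnCircle_eq hdq hω]
      omega
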